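/- **Conventions.** Let $L^+$ be the set of Lebesgue measurable functions $(0,\infty)\to[0,\infty]$. For $r>0$, $w\in L^+$ and a measurable function $h$ on $(0,\infty)$ put $\|h\|_{r,w}=\big(\int_0^\infty|h(t)|^r w(t)\,dt\big)^{1/r}\in[0,\infty]$. For a measurable $f$ on $(0,\infty)$ let $f^*(t)=\inf\{\lambda>0:|\{|f|>\lambda\}|\le t\}$ be its decreasing rearrangement with respect to Lebesgue measure, $f^{**}(t)=\frac1t\int_0^tf^*$, and $$\|f\|_{\Theta_r(w)}=\sup\{\|k^*\|_{r,w}: k \text{ measurable on }(0,\infty),\ k^{**}\le f^{**}\text{ on }(0,\infty)\}.$$ Let $P\cap\Omega_{2,0}$ be the cone of functions $h:(0,\infty)\to[0,\infty)$ such that $t^2h(t)$ is increasing, $h(t)$ is decreasing, and $h$ is constant on $(0,1)$ ("increasing" and "decreasing" in the weak sense). Let $\omega_z(t)=\min(t^{-2},z^{-2})$ for $z>0$. Let $\mathcal A$ be the class of averaging operators: for each family of pairwise disjoint bounded open intervals $(a_i,b_i)\subseteq(0,\infty)$, $i\in I$, the corresponding $A$ is given by $Af(x)=\frac1{b_i-a_i}\int_{a_i}^{b_i}f$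 if $x\in(a_i,b_i)$ and $Af(x)=f(x)$ if $x\notin\bigcup_i(a_i,b_i)$. For $u\in L^+$ let $u^o$ denote its level function: if $\int_0^xu$ is finite and bounded above by an affine function of $x$ on $(0,\infty)$, then $u^o$ is the decreasing function for which $\int_0^xu^o(t)\,dt$ is the least concave majorant of $\int_0^xu(t)\,dt$ on $(0,\infty)$; otherwise $u^o=\sup_n u_n^o$, where $u_n=\min(u,n)\chi_{(0,n)}$. For $0<p,q<\infty$ and $u,v\in L^+$ let $w(t)=t^{p-2}v(1/t)$ and $$C_\Theta=\sup_{h\in P\cap\Omega_{2,0}}\frac{\|h\|_{\Theta_{q/2}(u)}}{\|h\|_{p/2,v}},\qquad C_\omega=\sup_{z>1}\frac{\|\omega_z\|_{\Theta_{q/2}(u)}}{\|\omega_z\|_{p/2,v}}.$$ In all these and the following quotients and products, $0/0=\infty/\infty=0\cdot\infty=0$; in particular $a/b=a\,b^{-1}$ with $0^{-1}=\infty$ and $\infty^{-1}=0$. **Proposition 4.4.** Suppose $0<p<\infty$, $0<q<\infty$, and $u,v\in L^+$. 1. For any $p$ and $q$, $$C_\Theta\le \sup_{h\in P\cap\Omega_{2,0}}\bigg(\int_0^\infty\bigg(\frac1t\int_0^th(s)\,ds\bigg)^{q/2}u(t)\,dt\bigg)^{2/q}\bigg(\int_0^\infty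 h(t)^{p/2}v(t)\,dt\bigg)^{-2/p}.$$ 2. If $q\ge2$, then $$C_\Theta=\sup_{h\in P\cap\Omega_{2,0}}\sup_{A\in \mathcal{A}}\frac{\|Ah\|_{q/2,u}}{\|h\|_{p/2,v}}$$ and $$C_\Theta\le \sup_{h\in P\cap\Omega_{2,0}}\bigg(\int_0^\infty h(t)^{q/2}u^o(t)\,dt\bigg)^{2/q}\bigg(\int_0^\infty h(t)^{p/2}v(t)\,dt\bigg)^{-2/p}.$$ 3. If $p\le q$ and $q\ge2$, then, with $q'=q/(q-1)$, $$C_\Theta\le(4q')^{2/q}\sup_{1<1/x<y}\bigg(\frac 1{xy}\int_0^yu(t)\,dt\bigg)^{2/q}\bigg(\int_0^\infty\omega_x(t)^{p/2}w(t)\,dt\bigg)^{-2/p}.$$ 4. If $p\le2\le q$, then $C_\Theta\le 2C_\omega$. -/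

import Mathlib

open Set MeasureTheory
open scoped ENNReal NNReal

namespace LorentzSeries

noncomputable section

/-- Lebesgue measure on the half line `(0,∞)`. -/
def halfLine : Measure ℝ := volume.restrict (Ioi 0)

/-- `L⁺`: non-negative (extended real valued) Lebesgue measurable functions on `(0,∞)`.  Functions on
the half line are represented by functions on `ℝ` whose values outside `(0,∞)` are never used. -/
def LPlus : Set (ℝ → ℝ≥0∞) := {u | AEMeasurable u halfLine}

/-- The weighted Lebesgue (quasi-)norm `‖h‖_{p,w} = (∫₀^∞ h(t)^p w(t) dt)^{1/p}` of `h ≥ 0`. -/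
def wnorm (p : ℝ) (w h : ℝ → ℝ≥0∞) : ℝ≥0∞ :=
  (∫⁻ t in Ioi (0 : ℝ), h t ^ p * w t) ^ (1 / p)

/-- The decreasing rearrangement `f*(t) = inf {l > 0 : μ{|f| > l} ≤ t}`. -/
def rearr {X E : Type*} [MeasurableSpace X] [ENorm E] (μ : Measure X) (f : X → E) (t : ℝ) : ℝ≥0∞ :=
  sInf {l : ℝ≥0∞ | 0 < l ∧ μ {x | l < ‖f x‖ₑ} ≤ ENNReal.ofReal t}

/-- The mean `(1/t) ∫₀ᵗ h`. -/
def hardyMean (h : ℝ → ℝ≥0∞) (t : ℝ) : ℝ≥0∞ :=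
  (ENNReal.ofReal t)⁻¹ * ∫⁻ s in Ioo 0 t, h s

/-- `f** (t) = (1/t) ∫₀ᵗ f*`. -/
def rearr2 {X E : Type*} [MeasurableSpace X] [ENorm E] (μ : Measure X) (f : X → E) : ℝ → ℝ≥0∞ :=
  hardyMean (rearr μ f)

/-- `‖f‖_{Θ_p(w)} = sup ‖k*‖_{p,w}`, the supremum over all Lebesgue measurable functions `k` on
`(0,∞)` with `k** ≤ f**` on `(0,∞)`.  (If `f` is in `L¹ + L^∞`, then so is every such `k`.) -/
def thetaNorm {X E : Type*} [MeasurableSpace X] [ENorm E] (μ : Measure X)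
    (p : ℝ) (w : ℝ → ℝ≥0∞) (f : X → E) : ℝ≥0∞ :=
  ⨆ (k : ℝ → ℝ) (_ : AEMeasurable k halfLine)
    (_ : ∀ t : ℝ, 0 < t → rearr2 halfLine k t ≤ rearr2 μ f t), wnorm p w (rearr halfLine k)

/-- The cone `P ∩ Ω_{2,0}`: functions `h : (0,∞) → [0,∞)` such that `t² h(t)` is increasing,
`h` is decreasing, and `h` is constant on `(0,1)`. -/
def coneP : Set (ℝ → ℝ≥0) :=
  {h | MonotoneOn (fun t : ℝ => t ^ 2 * (h t : ℝ)) (Ioi 0) ∧ AntitoneOn h (Ioi 0) ∧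
    ∃ c : ℝ≥0, ∀ t ∈ Ioo (0 : ℝ) 1, h t = c}

/-- View a `[0,∞)`-valued function as a `[0,∞]`-valued one. -/
def toENN (h : ℝ → ℝ≥0) : ℝ → ℝ≥0∞ := fun t => (h t : ℝ≥0∞)

/-- `ω_z(t) = min(t⁻², z⁻²)`. -/
def omegaFn (z : ℝ) : ℝ → ℝ≥0∞ := fun t => ENNReal.ofReal (min (t ^ 2)⁻¹ (z ^ 2)⁻¹)

/-- `C_Θ = sup_{h ∈ P ∩ Ω_{2,0}} ‖h‖_{Θ_{q/2}(u)} / ‖h‖_{p/2,v}`, with `0/0 = ∞/∞ = 0`. -/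
def CTheta (p q : ℝ) (u v : ℝ → ℝ≥0∞) : ℝ≥0∞ :=
  ⨆ h ∈ coneP, thetaNorm halfLine (q / 2) u (toENN h) / wnorm (p / 2) v (toENN h)

/-- `C_ω = sup_{z > 1} ‖ω_z‖_{Θ_{q/2}(u)} / ‖ω_z‖_{p/2,v}`. -/
def COmega (p q : ℝ) (u v : ℝ → ℝ≥0∞) : ℝ≥0∞ :=
  ⨆ (z : ℝ) (_ : 1 < z), thetaNorm halfLine (q / 2) u (omegaFn z) / wnorm (p / 2) v (omegaFn z)

/-- The class `𝒜` of averaging operators: for some family `S` of pairwise disjoint bounded open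
subintervals `(a,b)` of `(0,∞)` (encoded by the pairs of their endpoints), `A f` is the mean of `f`
over `(a,b)` on each `(a,b)` in the family, and `A f = f` off the union of the family. -/
def averagingOperators : Set ((ℝ → ℝ≥0∞) → (ℝ → ℝ≥0∞)) :=
  {A | ∃ S : Set (ℝ × ℝ), (∀ I ∈ S, 0 ≤ I.1 ∧ I.1 < I.2) ∧
    S.PairwiseDisjoint (fun I => Ioo I.1 I.2) ∧
    ∀ f : ℝ → ℝ≥0∞,
      (∀ I ∈ S, ∀ x ∈ Ioo I.1 I.2,
        A f x = (ENNReal.ofReal (I.2 - I.1))⁻¹ * ∫⁻ t in Ioo I.1 I.2, f t) ∧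
      (∀ x, (∀ I ∈ S, x ∉ Ioo I.1 I.2) → A f x = f x)}

/-- `∫₀ˣ u(t) dt`. -/
def primitive (u : ℝ → ℝ≥0∞) (x : ℝ) : ℝ≥0∞ := ∫⁻ t in Ioo 0 x, u t

/-- `∫₀ˣ u` lies under some line on `(0,∞)`. -/
def UnderLine (u : ℝ → ℝ≥0∞) : Prop :=
  ∃ a b : ℝ, ∀ x : ℝ, 0 < x → primitive u x ≠ ∞ ∧ (primitive u x).toReal ≤ a + b * x

/-- The least concave majorant of `U` on `(0,∞)`, as the pointwise infimum of all concave majorants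
(used only for functions that have one). -/
def leastConcaveMajorant (U : ℝ → ℝ) (x : ℝ) : ℝ :=
  sInf {c | ∃ G : ℝ → ℝ, ConcaveOn ℝ (Ioi 0) G ∧ (∀ y ∈ Ioi (0 : ℝ), U y ≤ G y) ∧ c = G x}

/-- The level function when `∫₀ˣ u` lies under a line: the decreasing function whose integral is the
least concave majorant of `∫₀ˣ u`, taken to be the right derivative of that majorant. -/
def levelFunction₀ (u : ℝ → ℝ≥0∞) (x : ℝ) : ℝ≥0∞ :=
  ENNReal.ofReal
    (derivWithin (leastConcaveMajorant fun y => (primitive u y).toReal) (Ioi x) x)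

/-- The truncation `min(u, n) χ_{(0,n)}`, whose integral lies under the line `n x`. -/
def truncation (n : ℕ) (u : ℝ → ℝ≥0∞) : ℝ → ℝ≥0∞ :=
  (Iio (n : ℝ)).indicator fun t => min (u t) n

open Classical in
/-- The level function `u°` with respect to Lebesgue measure on `(0,∞)`.  If `∫₀ˣ u` does not lie under
a line it is the limit of the level functions of the truncations, which increase to `u`. -/
def levelFunction (u : ℝ → ℝ≥0∞) (x : ℝ) : ℝ≥0∞ :=
  if UnderLine u then levelFunction₀ u x else ⨆ n : ℕ, levelFunction₀ (truncation n u) x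

/-- The weight `w(t) = t^{p-2} v(1/t)`. -/
def dualWeight (p : ℝ) (v : ℝ → ℝ≥0∞) : ℝ → ℝ≥0∞ :=
  fun t => ENNReal.ofReal (t ^ (p - 2)) * v (1 / t)

end

end LorentzSeries

open LorentzSeries

/-! The competitors in the norm of `Θ` are the decreasing rearrangements `g = k*`, and those satisfy
`∫₀ʸ g ≤ ∫₀ʸ h` for all `y` (`majorizes_rearr`). The first bound is then `k* ≤ k** ≤ h**`.

For the formula with averaging operators, put `r = q/2 ≥ 1` and let `u` be bounded with bounded
support, to which truncation reduces the matter. The level function `ψ` of `φ = g^(r-1) u` is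
decreasing, its primitive majorizes that of `φ`, and it is the image `A φ` of `φ` under the
averaging operator of the level intervals (`exists_isAveraging_eq_levelFunction₀`). Hardy's lemma,
used for the decreasing functions `g` and `ψ`, and the symmetry of `A` give
`∫ g^r u = ∫ g φ ≤ ∫ g ψ ≤ ∫ h ψ = ∫ (A h) g^(r-1) u`, and Young's inequality cancels `g^(r-1)`.
In the other direction, `A h` is decreasing with `∫₀ʸ A h ≤ ∫₀ʸ h`, so it is a competitor. The
bound by the level function of `u` follows from two further applications of Hardy's lemma and the
same cancellation.

The last two bounds rest on a decomposition of the cone (`exists_omega_sum`): as a function of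
`s = t^(2r)`, the product `s h^r` is quasi-concave, so its least concave majorant is at most twice
as large, and inscribed polygons of that majorant are positive combinations of the functions
`s ω_z^r`. The inequality is thereby reduced to the `ω_z`, with the loss of a factor `2`. On the
side of `u` the terms are put together by the additivity of the integral against the level function
(with `r = q/2`) or by the triangle inequality for averages (with `r = 1`), and on the side of `v`
by the reverse Minkowski inequality for exponents at most one. For `h = ω_z` the norm weighted by the
level function is computed from the bound `∫₀ʸ u ≤ K y`, which the least concave majorant inherits
with a further factor `2`. -/

/-! ### Hardy's lemma and the reverse Minkowski inequality -/

theorem measurable_of_antitoneOn {f : ℝ → ℝ≥0∞} (hf : AntitoneOn f (Ioi 0)) :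
    AEMeasurable f (volume.restrict (Ioi 0)) :=
  aemeasurable_restrict_of_antitoneOn measurableSet_Ioi hf

theorem lowerSet_Ioi_cases {D : Set ℝ} (hD : D ⊆ Ioi 0)
    (hl : ∀ s ∈ D, ∀ t, 0 < t → t ≤ s → t ∈ D) :
    D = ∅ ∨ D = Ioi 0 ∨ ∃ y, 0 < y ∧ Ioo 0 y ⊆ D ∧ D ⊆ Ioc 0 y := by
  rcases D.eq_empty_or_nonempty with h | ⟨d, hd⟩
  · exact Or.inl h
  right
  by_cases hb : BddAbove D
  · right
    refine ⟨sSup D, lt_of_lt_of_le (hD hd) (le_csSup hb hd), ?_,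
      fun t ht => ⟨hD ht, le_csSup hb ht⟩⟩
    rintro t ⟨h0, h1⟩
    obtain ⟨s, hs, hts⟩ := exists_lt_of_lt_csSup ⟨d, hd⟩ h1
    exact hl s hs t h0 hts.le
  · left
    refine hD.antisymm fun t ht => ?_
    rw [not_bddAbove_iff] at hb
    obtain ⟨s, hs, hts⟩ := hb t
    exact hl s hs t ht hts.le

theorem iUnion_Ioo_nat : (⋃ n : ℕ, Ioo (0 : ℝ) n) = Ioi 0 := by
  ext t
  simp only [mem_iUnion, mem_Ioo, mem_Ioi]
  exact ⟨fun ⟨_, h⟩ => h.1, fun h => (exists_nat_gt t).imp fun n hn => ⟨h, hn⟩⟩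

theorem lintegral_Ioi_eq_iSup (a : ℝ → ℝ≥0∞) :
    ∫⁻ t in Ioi (0 : ℝ), a t = ⨆ n : ℕ, ∫⁻ t in Ioo (0 : ℝ) n, a t := by
  rw [← iUnion_Ioo_nat, setLIntegral_iUnion_of_directed]
  exact Monotone.directed_le fun m n h => Ioo_subset_Ioo le_rfl (by exact_mod_cast h)

/-- Hardy's lemma: for decreasing `f`, `∫ f a` is monotone in the primitive of `a`, by integration
over the level sets of `f`. If `f` is constant on `(0, z)`, only the primitive beyond `z`
matters. -/
theorem hardy_lemma {f a b : ℝ → ℝ≥0∞} {z : ℝ} (hf : AntitoneOn f (Ioi 0))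
    (hfin : ∀ t, 0 < t → f t ≠ ∞) (hz : ∀ s ∈ Ioo 0 z, ∀ t ∈ Ioo 0 z, f s = f t)
    (ha : AEMeasurable a (volume.restrict (Ioi 0))) (hb : AEMeasurable b (volume.restrict (Ioi 0)))
    (hab : ∀ y, 0 < y → z ≤ y → ∫⁻ t in Ioo 0 y, a t ≤ ∫⁻ t in Ioo 0 y, b t) :
    ∫⁻ t in Ioi (0 : ℝ), f t * a t ≤ ∫⁻ t in Ioi (0 : ℝ), f t * b t := by
  have hfm := measurable_of_antitoneOn hf
  have key : ∀ {c : ℝ → ℝ≥0∞}, AEMeasurable c (volume.restrict (Ioi 0)) →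
      ∫⁻ t in Ioi (0 : ℝ), f t * c t =
        ∫⁻ l in Ioi (0 : ℝ), ∫⁻ t in {t | l < (f t).toReal} ∩ Ioi 0, c t := by
    intro c hc
    have hac := withDensity_absolutelyContinuous (volume.restrict (Ioi (0 : ℝ))) c
    have h1 : ∫⁻ t, ENNReal.ofReal (f t).toReal ∂((volume.restrict (Ioi 0)).withDensity c) =
        ∫⁻ t in Ioi (0 : ℝ), f t * c t := by
      rw [lintegral_withDensity_eq_lintegral_mul₀ hc hfm.ennreal_toReal.ennreal_ofReal]
      refine setLIntegral_congr_fun measurableSet_Ioi fun t ht => ?_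
      simp only [Pi.mul_apply, ENNReal.ofReal_toReal (hfin t ht), mul_comm]
    rw [← h1, lintegral_eq_lintegral_meas_lt _ (Filter.Eventually.of_forall fun _ =>
      ENNReal.toReal_nonneg) (hfm.ennreal_toReal.mono_ac hac)]
    refine lintegral_congr fun l => ?_
    rw [withDensity_apply', Measure.restrict_restrict' measurableSet_Ioi]
  rw [key ha, key hb]
  refine lintegral_mono fun l => ?_
  set D := {t | l < (f t).toReal} ∩ Ioi 0
  have hl : ∀ s ∈ D, ∀ t, 0 < t → t ≤ s → t ∈ D := fun s hs t ht hts =>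
    ⟨lt_of_lt_of_le hs.1 (ENNReal.toReal_mono (hfin t ht) (hf ht hs.2 hts)), ht⟩
  rcases lowerSet_Ioi_cases inter_subset_right hl with h | h | ⟨y, hy, h1, h2⟩
  · rw [show D = ∅ from h]; simp
  · rw [show D = Ioi 0 from h, lintegral_Ioi_eq_iSup, lintegral_Ioi_eq_iSup]
    obtain ⟨N, hN⟩ := exists_nat_gt (max 0 z)
    refine iSup_le fun n => ?_
    have hN' : max 0 z < ((max n N : ℕ) : ℝ) := hN.trans_le (by exact_mod_cast le_max_right _ _)
    refine le_trans (lintegral_mono_set (Ioo_subset_Ioo le_rfl ?_))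
      ((hab (max n N : ℕ) ((le_max_left _ _).trans_lt hN') ((le_max_right _ _).trans hN'.le)).trans
      (le_iSup (fun n : ℕ => ∫⁻ t in Ioo (0 : ℝ) n, b t) _))
    exact_mod_cast le_max_left _ _
  · have hzy : z ≤ y := by
      by_contra! hc
      have hm : y / 2 ∈ D := h1 ⟨by linarith, by linarith⟩
      have hm' : (y + z) / 2 ∈ D := by
        refine ⟨?_, by simp only [mem_Ioi]; linarith⟩
        have := hm.1
        simp only [mem_ofPred_eq] at this ⊢
        rwa [hz ((y + z) / 2) ⟨by linarith, by linarith⟩ (y / 2) ⟨by linarith, by linarith⟩]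
      have := (h2 hm').2
      linarith
    have hae : D =ᵐ[volume] Ioo 0 y :=
      (h2.eventuallyLE.trans Ioo_ae_eq_Ioc.symm.le).antisymm h1.eventuallyLE
    rw [setLIntegral_congr hae, setLIntegral_congr hae]
    exact hab y hy hzy

/-- Young's inequality for `a * g ^ (r - 1)`, in a form that includes `r = 1`. -/
theorem mul_rpow_sub_one_le {r : ℝ} (hr : 1 ≤ r) {a g : ℝ≥0∞} (ha : a ≠ ∞) (hg : g ≠ ∞) :
    a * g ^ (r - 1) ≤ ENNReal.ofReal r⁻¹ * a ^ r + ENNReal.ofReal (1 - r⁻¹) * g ^ r := by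
  have hr0 : 0 < r := by linarith
  have hri : r⁻¹ ≤ 1 := inv_le_one_of_one_le₀ hr
  lift a to ℝ≥0 using ha
  lift g to ℝ≥0 using hg
  have h := Real.geom_mean_le_arith_mean2_weighted (w₁ := r⁻¹) (w₂ := 1 - r⁻¹)
    (p₁ := (a : ℝ) ^ r) (p₂ := (g : ℝ) ^ r) (by positivity) (by linarith) (by positivity)
    (by positivity) (by ring)
  rw [← Real.rpow_mul (NNReal.coe_nonneg a), ← Real.rpow_mul (NNReal.coe_nonneg g),
    mul_inv_cancel₀ hr0.ne', Real.rpow_one,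
    show r * (1 - r⁻¹) = r - 1 by field_simp] at h
  rw [← ENNReal.coe_rpow_of_nonneg _ (by linarith), ← ENNReal.coe_rpow_of_nonneg _ hr0.le,
    ← ENNReal.coe_rpow_of_nonneg _ hr0.le]
  have h' := ENNReal.ofReal_le_ofReal h
  rw [ENNReal.ofReal_add (by positivity) (mul_nonneg (by linarith) (by positivity)),
    ENNReal.ofReal_mul (by positivity), ENNReal.ofReal_mul (by positivity),
    ENNReal.ofReal_mul (by linarith)] at h'
  simpa [← NNReal.coe_rpow] using h'

/-- Replaces Hölder's inequality followed by division by a power of `∫ g ^ r w`. -/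
theorem lintegral_rpow_le_of_le_mul {r : ℝ} (hr : 1 ≤ r) {a g w : ℝ → ℝ≥0∞} {μ : Measure ℝ}
    (ha : ∀ᵐ t ∂μ, a t ≠ ∞) (hg : ∀ᵐ t ∂μ, g t ≠ ∞) (ham : AEMeasurable a μ)
    (hw : AEMeasurable w μ) (hfin : ∫⁻ t, g t ^ r * w t ∂μ ≠ ∞)
    (h : ∫⁻ t, g t ^ r * w t ∂μ ≤ ∫⁻ t, a t * (g t ^ (r - 1) * w t) ∂μ) :
    ∫⁻ t, g t ^ r * w t ∂μ ≤ ∫⁻ t, a t ^ r * w t ∂μ := by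
  have hr0 : 0 < r := by linarith
  have hri : r⁻¹ ≤ 1 := inv_le_one_of_one_le₀ hr
  set X := ∫⁻ t, g t ^ r * w t ∂μ
  set Y := ∫⁻ t, a t ^ r * w t ∂μ
  have h1 : X ≤ ENNReal.ofReal r⁻¹ * Y + ENNReal.ofReal (1 - r⁻¹) * X := by
    refine h.trans ?_
    rw [← lintegral_const_mul' _ _ ENNReal.ofReal_ne_top,
      ← lintegral_const_mul' _ _ ENNReal.ofReal_ne_top,
      ← lintegral_add_left' (f := fun t => ENNReal.ofReal r⁻¹ * (a t ^ r * w t))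
        (((ham.pow_const r).mul hw).const_mul _)]
    refine lintegral_mono_ae ?_
    filter_upwards [ha, hg] with t hat hgt
    have := mul_le_mul_left (mul_rpow_sub_one_le hr hat hgt) (w t)
    rw [add_mul] at this
    simpa only [mul_assoc] using this
  by_cases hY : Y = ∞
  · simp [hY]
  rw [← ENNReal.toReal_le_toReal hfin hY]
  have h2 := ENNReal.toReal_mono (by finiteness) h1
  rw [ENNReal.toReal_add (by finiteness) (by finiteness), ENNReal.toReal_mul, ENNReal.toReal_mul,
    ENNReal.toReal_ofReal (by positivity), ENNReal.toReal_ofReal (by linarith)] at h2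
  have h3 : r⁻¹ * X.toReal ≤ r⁻¹ * Y.toReal := by linarith
  exact le_of_mul_le_mul_left h3 (by positivity)

/-- Concavity of `x ↦ x ^ ρ` at the convex
combination `(x + y) / (A + B)` of `x / A` and `y / B`. -/
theorem rpow_add_le_weighted {ρ : ℝ} (h0 : 0 < ρ) (h1 : ρ ≤ 1) {A B : ℝ≥0∞} (hA : A ≠ 0)
    (hB : B ≠ 0) (hA' : A ≠ ∞) (hB' : B ≠ ∞) (x y : ℝ≥0∞) :
    A / (A + B) * (x / A) ^ ρ + B / (A + B) * (y / B) ^ ρ ≤ ((x + y) / (A + B)) ^ ρ := by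
  have hAB : A + B ≠ ∞ := by finiteness
  have hAB0 : A + B ≠ 0 := by simp [hA]
  have hs : A / (A + B) + B / (A + B) = 1 := by
    rw [← ENNReal.add_div, ENNReal.div_self hAB0 hAB]
  have h := ENNReal.rpow_arith_mean_le_arith_mean2_rpow (A / (A + B)) (B / (A + B))
    ((x / A) ^ ρ) ((y / B) ^ ρ) hs (p := 1 / ρ) (by rw [le_div_iff₀ h0]; linarith)
  rw [← ENNReal.rpow_mul, ← ENNReal.rpow_mul, mul_one_div_cancel h0.ne', ENNReal.rpow_one,
    ENNReal.rpow_one] at h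
  have e1 : A / (A + B) * (x / A) = x / (A + B) := by
    rw [ENNReal.div_eq_inv_mul, ENNReal.div_eq_inv_mul, ENNReal.div_eq_inv_mul,
      mul_assoc, ← mul_assoc A, ENNReal.mul_inv_cancel hA hA', one_mul]
  have e2 : B / (A + B) * (y / B) = y / (A + B) := by
    rw [ENNReal.div_eq_inv_mul, ENNReal.div_eq_inv_mul, ENNReal.div_eq_inv_mul,
      mul_assoc, ← mul_assoc B, ENNReal.mul_inv_cancel hB hB', one_mul]
  rw [e1, e2, ← ENNReal.add_div] at h
  have := ENNReal.rpow_le_rpow h h0.le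
  rwa [← ENNReal.rpow_mul, one_div_mul_cancel h0.ne', ENNReal.rpow_one] at this

/-- For exponents at most one the triangle inequality is reversed: normalize both functions and
integrate the concavity inequality. -/
theorem reverse_minkowski {α : Type*} [MeasurableSpace α] {μ : Measure α} {ρ : ℝ} (h0 : 0 < ρ)
    (h1 : ρ ≤ 1) {f g : α → ℝ≥0∞} (hf : AEMeasurable f μ) :
    (∫⁻ t, f t ^ ρ ∂μ) ^ (1 / ρ) + (∫⁻ t, g t ^ ρ ∂μ) ^ (1 / ρ) ≤
      (∫⁻ t, (f t + g t) ^ ρ ∂μ) ^ (1 / ρ) := by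
  have hi : 0 < 1 / ρ := by positivity
  set A := (∫⁻ t, f t ^ ρ ∂μ) ^ (1 / ρ)
  set B := (∫⁻ t, g t ^ ρ ∂μ) ^ (1 / ρ)
  have hAle : A ≤ (∫⁻ t, (f t + g t) ^ ρ ∂μ) ^ (1 / ρ) :=
    ENNReal.rpow_le_rpow (lintegral_mono fun t => ENNReal.rpow_le_rpow le_self_add h0.le) hi.le
  have hBle : B ≤ (∫⁻ t, (f t + g t) ^ ρ ∂μ) ^ (1 / ρ) :=
    ENNReal.rpow_le_rpow (lintegral_mono fun t => ENNReal.rpow_le_rpow le_add_self h0.le) hi.le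
  by_cases hA : A = 0
  · simpa [hA] using hBle
  by_cases hB : B = 0
  · simpa [hB] using hAle
  by_cases hA' : A = ∞
  · rw [hA'] at hAle ⊢; simpa using hAle
  by_cases hB' : B = ∞
  · rw [hB'] at hBle ⊢; simpa using hBle
  have hAB : A + B ≠ ∞ := by finiteness
  have hAB0 : A + B ≠ 0 := by simp [hA]
  have eA : A ^ ρ = ∫⁻ t, f t ^ ρ ∂μ := by
    rw [← ENNReal.rpow_mul, one_div_mul_cancel h0.ne', ENNReal.rpow_one]
  have eB : B ^ ρ = ∫⁻ t, g t ^ ρ ∂μ := by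
    rw [← ENNReal.rpow_mul, one_div_mul_cancel h0.ne', ENNReal.rpow_one]
  have hn : ∀ {C : ℝ≥0∞} (F : α → ℝ≥0∞), C ≠ 0 → C ≠ ∞ →
      ∫⁻ t, (F t / C) ^ ρ ∂μ = (∫⁻ t, F t ^ ρ ∂μ) / C ^ ρ := by
    intro C F hC hC'
    simp_rw [ENNReal.div_rpow_of_nonneg _ _ h0.le, div_eq_mul_inv]
    rw [lintegral_mul_const' _ _ (by simp [hC, hC', h0])]
  have hone : ∀ {C : ℝ≥0∞}, C ≠ 0 → C ≠ ∞ → C ^ ρ / C ^ ρ = 1 := fun hC hC' =>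
    ENNReal.div_self (by simp [hC, hC', h0]) (by simp [hC, hC', h0])
  have key : 1 ≤ (∫⁻ t, (f t + g t) ^ ρ ∂μ) / (A + B) ^ ρ := by
    rw [← hn _ hAB0 hAB]
    refine le_trans (le_of_eq ?_)
      (lintegral_mono fun t => rpow_add_le_weighted h0 h1 hA hB hA' hB' (f t) (g t))
    rw [lintegral_add_left' (((hf.div_const _).pow_const _).const_mul _),
      lintegral_const_mul' _ _ (ENNReal.div_ne_top hA' hAB0),
      lintegral_const_mul' _ _ (ENNReal.div_ne_top hB' hAB0), hn _ hA hA', hn _ hB hB', ← eA, ← eB,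
      hone hA hA', hone hB hB', mul_one, mul_one, ← ENNReal.add_div, ENNReal.div_self hAB0 hAB]
  rw [ENNReal.le_div_iff_mul_le (by simp [hAB0, hAB, h0]) (by simp [hAB0, hAB, h0]), one_mul] at key
  have := ENNReal.rpow_le_rpow key hi.le
  rwa [← ENNReal.rpow_mul, mul_one_div_cancel h0.ne', ENNReal.rpow_one] at this

theorem reverse_minkowski_sum {α ι : Type*} [MeasurableSpace α] {μ : Measure α} {ρ : ℝ}
    (h0 : 0 < ρ) (h1 : ρ ≤ 1) (s : Finset ι) {f : ι → α → ℝ≥0∞}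
    (hf : ∀ i ∈ s, AEMeasurable (f i) μ) :
    ∑ i ∈ s, (∫⁻ t, f i t ^ ρ ∂μ) ^ (1 / ρ) ≤ (∫⁻ t, (∑ i ∈ s, f i t) ^ ρ ∂μ) ^ (1 / ρ) := by
  classical
  induction s using Finset.induction_on with
  | empty => simp
  | insert i s hi ih =>
    simp only [Finset.sum_insert hi]
    exact (add_le_add le_rfl (ih fun j hj => hf j (Finset.mem_insert_of_mem hj))).trans
      (reverse_minkowski h0 h1 (hf i (Finset.mem_insert_self _ _)))

/-! ### Concave functions on the half line and least concave majorants -/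

section Concave

variable {L U : ℝ → ℝ}

theorem ConcaveOn.monotoneOn_of_nonneg (hL : ConcaveOn ℝ (Ioi 0) L) (h0 : ∀ x, 0 < x → 0 ≤ L x) :
    MonotoneOn L (Ioi 0) := by
  intro x hx y hy hxy
  rcases hxy.eq_or_lt with rfl | hxy
  · exact le_rfl
  by_contra! hc
  have hx' : 0 < x := hx
  have hy' : 0 < y := hy
  have hs : 0 < (L x - L y) / (y - x) := div_pos (by linarith) (by linarith)
  set s := (L x - L y) / (y - x)
  have hd : 0 < (L y + 1) / s := div_pos (by linarith [h0 y hy]) hs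
  have h := hL.slope_anti_adjacent hx (z := y + (L y + 1) / s) (by simp only [mem_Ioi]; linarith)
    hxy (by linarith)
  have hz := h0 (y + (L y + 1) / s) (by linarith)
  rw [show (L y - L x) / (y - x) = -s by simp only [s]; rw [← neg_div]; ring_nf,
    div_le_iff₀ (by linarith)] at h
  have : -s * (y + (L y + 1) / s - y) = -(L y + 1) := by field_simp; ring
  linarith

/-- A non-negative concave function `L` on the half line is quasi-concave:
`L x / x` is decreasing. -/
theorem ConcaveOn.mul_le_mul_of_nonneg (hL : ConcaveOn ℝ (Ioi 0) L)
    (h0 : ∀ x, 0 < x → 0 ≤ L x) {x y : ℝ} (hx : 0 < x) (hxy : x ≤ y) : x * L y ≤ y * L x := by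
  rcases hxy.eq_or_lt with rfl | hxy
  · exact le_rfl
  have key : ∀ᶠ ε in nhdsWithin (0 : ℝ) (Ioi 0), (L y - L x) * (x - ε) ≤ L x * (y - x) := by
    filter_upwards [Ioo_mem_nhdsGT hx] with ε hε
    have h := hL.slope_anti_adjacent (mem_Ioi.2 hε.1) (mem_Ioi.2 (hx.trans hxy)) hε.2 hxy
    rw [div_le_div_iff₀ (by linarith) (by linarith [hε.2])] at h
    nlinarith [h0 ε hε.1]
  have hlim : Filter.Tendsto (fun ε => (L y - L x) * (x - ε)) (nhdsWithin (0 : ℝ) (Ioi 0))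
      (nhds ((L y - L x) * (x - 0))) :=
    (Continuous.tendsto (by fun_prop) 0).mono_left nhdsWithin_le_nhds
  have := le_of_tendsto hlim key
  linarith

theorem ConcaveOn.indicator_Ici (hL : ConcaveOn ℝ (Ioi 0) L) (h0 : ∀ x, 0 < x → 0 ≤ L x) :
    ConcaveOn ℝ (Ici 0) ((Ioi 0).indicator L) := by
  have key : ∀ y b : ℝ, 0 ≤ y → 0 ≤ b → b ≤ 1 →
      b * (Ioi 0).indicator L y ≤ (Ioi 0).indicator L (b * y) := by
    intro y b hy hb hb1
    rcases hy.eq_or_lt with rfl | hy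
    · simp
    rcases hb.eq_or_lt with rfl | hb
    · simp
    have hby : 0 < b * y := mul_pos hb hy
    rw [indicator_of_mem (mem_Ioi.2 hy), indicator_of_mem (mem_Ioi.2 hby)]
    have := hL.mul_le_mul_of_nonneg h0 hby (by nlinarith : b * y ≤ y)
    nlinarith
  refine ⟨convex_Ici 0, fun x hx y hy a b ha hb hab => ?_⟩
  simp only [smul_eq_mul]
  rcases (show (0 : ℝ) ≤ x from hx).eq_or_lt with rfl | hx
  · simpa using key y b hy hb (by linarith)
  rcases (show (0 : ℝ) ≤ y from hy).eq_or_lt with rfl | hy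
  · simpa using key x a hx.le ha (by linarith)
  have hm : 0 < a * x + b * y := (convex_Ioi (0 : ℝ)) (mem_Ioi.2 hx) (mem_Ioi.2 hy) ha hb hab
  rw [indicator_of_mem (mem_Ioi.2 hx), indicator_of_mem (mem_Ioi.2 hy),
    indicator_of_mem (mem_Ioi.2 hm)]
  exact hL.2 (mem_Ioi.2 hx) (mem_Ioi.2 hy) ha hb hab

theorem ConcaveOn.continuousOn_indicator_Ici (hL : ConcaveOn ℝ (Ioi 0) L)
    (h0 : ∀ x, 0 < x → 0 ≤ L x) (hz : ∀ ε > 0, ∃ M, ∀ x, 0 < x → L x ≤ ε + M * x) :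
    ContinuousOn ((Ioi 0).indicator L) (Ici 0) := by
  intro x hx
  rcases (show (0 : ℝ) ≤ x from hx).eq_or_lt with rfl | hx
  · rw [Metric.continuousWithinAt_iff]
    intro ε hε
    obtain ⟨M, hM⟩ := hz (ε / 2) (by linarith)
    refine ⟨ε / (2 * (|M| + 1)), by positivity, fun {y} hy hd => ?_⟩
    rcases (show (0 : ℝ) ≤ y from hy).eq_or_lt with rfl | hy
    · simpa using hε
    rw [indicator_of_mem (mem_Ioi.2 hy), indicator_of_notMem (by simp), Real.dist_eq, sub_zero,
      abs_of_nonneg (h0 y hy)]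
    rw [Real.dist_eq, sub_zero, abs_of_pos hy, lt_div_iff₀ (by positivity)] at hd
    have := hM y hy
    have := le_abs_self M
    nlinarith
  · have hc := (hL.continuousOn isOpen_Ioi).continuousAt (Ioi_mem_nhds hx)
    refine (hc.congr ?_).continuousWithinAt
    filter_upwards [Ioi_mem_nhds hx] with y hy
    rw [indicator_of_mem hy]

theorem ConcaveOn.hasDerivWithinAt_Ioi (hL : ConcaveOn ℝ (Ioi 0) L) {x : ℝ} (hx : 0 < x) :
    HasDerivWithinAt L (derivWithin L (Ioi x) x) (Ioi x) x := by
  have h := (hL.neg.hasDerivWithinAt_rightDeriv_of_mem_interior (x := x)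
    (by rwa [interior_Ioi])).neg
  rw [neg_neg] at h
  exact h.differentiableWithinAt.hasDerivWithinAt

theorem ConcaveOn.antitoneOn_rightDeriv (hL : ConcaveOn ℝ (Ioi 0) L) :
    AntitoneOn (fun x => derivWithin L (Ioi x) x) (Ioi 0) := by
  intro x hx y hy hxy
  have h := hL.neg.monotoneOn_rightDeriv (by rwa [interior_Ioi]) (by rwa [interior_Ioi]) hxy
  simp only [derivWithin.neg] at h
  linarith

theorem ConcaveOn.rightDeriv_nonneg (hL : ConcaveOn ℝ (Ioi 0) L) (h0 : ∀ x, 0 < x → 0 ≤ L x)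
    {x : ℝ} (hx : 0 < x) : 0 ≤ derivWithin L (Ioi x) x := by
  have h := hL.slope_le_of_hasDerivWithinAt_Ioi (mem_Ioi.2 hx) (mem_Ioi.2 (by linarith : 0 < x + 1))
    (by linarith) (hL.hasDerivWithinAt_Ioi hx)
  refine le_trans ?_ h
  rw [slope_def_field]
  exact div_nonneg (sub_nonneg.2 (hL.monotoneOn_of_nonneg h0 (mem_Ioi.2 hx)
    (mem_Ioi.2 (by linarith)) (by linarith))) (by linarith)

/-- A non-negative concave function that tends to zero at the origin is the integral of its right
derivative. -/
theorem ConcaveOn.lintegral_rightDeriv (hL : ConcaveOn ℝ (Ioi 0) L) (h0 : ∀ x, 0 < x → 0 ≤ L x)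
    (hz : ∀ ε > 0, ∃ M, ∀ x, 0 < x → L x ≤ ε + M * x) {x : ℝ} (hx : 0 < x) :
    ∫⁻ t in Ioo 0 x, ENNReal.ofReal (derivWithin L (Ioi t) t) = ENNReal.ofReal (L x) := by
  have hc : ContinuousOn ((Ioi 0).indicator L) (Icc 0 x) :=
    (hL.continuousOn_indicator_Ici h0 hz).mono Icc_subset_Ici_self
  have hd : ∀ t ∈ Ioo 0 x, HasDerivWithinAt ((Ioi 0).indicator L)
      (derivWithin L (Ioi t) t) (Ioi t) t := by
    intro t ht
    refine (hL.hasDerivWithinAt_Ioi ht.1).congr (fun y hy => ?_) ?_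
    · rw [indicator_of_mem (mem_Ioi.2 (ht.1.trans hy))]
    · rw [indicator_of_mem (mem_Ioi.2 ht.1)]
  have hp : ∀ t ∈ Ioo 0 x, 0 ≤ derivWithin L (Ioi t) t := fun t ht => hL.rightDeriv_nonneg h0 ht.1
  have hi := intervalIntegral.integrableOn_deriv_right_of_nonneg hc hd hp
  have h := intervalIntegral.integral_eq_sub_of_hasDeriv_right_of_le hx.le hc hd
    ((intervalIntegrable_iff_integrableOn_Ioc_of_le hx.le).2 hi)
  rw [intervalIntegral.integral_of_le hx.le, integral_Ioc_eq_integral_Ioo,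
    indicator_of_mem (mem_Ioi.2 hx), indicator_of_notMem (by simp), sub_zero] at h
  rw [← h, ofReal_integral_eq_lintegral_ofReal (hi.mono_set Ioo_subset_Ioc_self)]
  exact (ae_restrict_iff' measurableSet_Ioo).2 (Filter.Eventually.of_forall hp)

theorem concaveOn_line (a b : ℝ) (s : Set ℝ) (hs : Convex ℝ s) :
    ConcaveOn ℝ s fun x => a + b * x := by
  refine ⟨hs, fun x _ y _ c d _ _ hcd => le_of_eq ?_⟩
  simp only [smul_eq_mul]
  linear_combination a * hcd

theorem leastConcaveMajorant_le {G : ℝ → ℝ} (hG : ConcaveOn ℝ (Ioi 0) G)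
    (hUG : ∀ y ∈ Ioi (0 : ℝ), U y ≤ G y) {x : ℝ} (hx : 0 < x) : leastConcaveMajorant U x ≤ G x :=
  csInf_le ⟨U x, fun _ ⟨_, _, h, hc⟩ => hc ▸ h x hx⟩ ⟨G, hG, hUG, rfl⟩

theorem le_leastConcaveMajorant_of_forall
    (hU : ∃ G : ℝ → ℝ, ConcaveOn ℝ (Ioi 0) G ∧ ∀ y ∈ Ioi (0 : ℝ), U y ≤ G y) {x c : ℝ}
    (h : ∀ G : ℝ → ℝ, ConcaveOn ℝ (Ioi 0) G → (∀ y ∈ Ioi (0 : ℝ), U y ≤ G y) → c ≤ G x) :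
    c ≤ leastConcaveMajorant U x := by
  obtain ⟨G, hG, hUG⟩ := hU
  exact le_csInf ⟨G x, G, hG, hUG, rfl⟩ fun _ ⟨G', h1, h2, hc⟩ => hc ▸ h G' h1 h2

theorem le_leastConcaveMajorant
    (hU : ∃ G : ℝ → ℝ, ConcaveOn ℝ (Ioi 0) G ∧ ∀ y ∈ Ioi (0 : ℝ), U y ≤ G y) {x : ℝ} (hx : 0 < x) :
    U x ≤ leastConcaveMajorant U x :=
  le_leastConcaveMajorant_of_forall hU fun _ _ h => h x hx

theorem concaveOn_leastConcaveMajorant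
    (hU : ∃ G : ℝ → ℝ, ConcaveOn ℝ (Ioi 0) G ∧ ∀ y ∈ Ioi (0 : ℝ), U y ≤ G y) :
    ConcaveOn ℝ (Ioi 0) (leastConcaveMajorant U) := by
  refine ⟨convex_Ioi 0, fun x hx y hy a b ha hb hab => ?_⟩
  refine le_leastConcaveMajorant_of_forall hU fun G hG hUG => le_trans ?_ (hG.2 hx hy ha hb hab)
  exact add_le_add (mul_le_mul_of_nonneg_left (leastConcaveMajorant_le hG hUG hx) ha)
    (mul_le_mul_of_nonneg_left (leastConcaveMajorant_le hG hUG hy) hb)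

end Concave

/-! ### Level functions of functions whose primitive lies under a line -/

section LevelFunction

variable {u : ℝ → ℝ≥0∞}

theorem LorentzSeries.UnderLine.exists_concave (hu : UnderLine u) :
    ∃ G : ℝ → ℝ, ConcaveOn ℝ (Ioi 0) G ∧ ∀ y ∈ Ioi (0 : ℝ), (primitive u y).toReal ≤ G y := by
  obtain ⟨a, b, h⟩ := hu
  exact ⟨fun x => a + b * x, concaveOn_line a b _ (convex_Ioi 0), fun y hy => (h y hy).2⟩

/-- The least concave majorant of a primitive that lies under a line tends to zero at the origin:
every steep enough line through a point just above the origin is a majorant. -/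
theorem LorentzSeries.UnderLine.leastConcaveMajorant_le_line (hu : UnderLine u) :
    ∀ ε > 0, ∃ M, ∀ x, 0 < x →
      leastConcaveMajorant (fun y => (primitive u y).toReal) x ≤ ε + M * x := by
  intro ε hε
  obtain ⟨a, b, h⟩ := hu
  obtain ⟨δ, hδ, hd⟩ := exists_pos_setLIntegral_lt_of_measure_lt (μ := volume.restrict (Ioo 0 1))
    (f := u) (h 1 one_pos).1 (ε := ENNReal.ofReal ε) (by simpa using hε)
  obtain ⟨η, hη, hηδ⟩ : ∃ η : ℝ, 0 < η ∧ η ≤ 1 ∧ ENNReal.ofReal η < δ := by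
    obtain ⟨η, h1, h2⟩ := ENNReal.lt_iff_exists_nnreal_btwn.1 hδ
    refine ⟨min η 1, by simpa using h1, min_le_right _ _, lt_of_le_of_lt ?_ h2⟩
    rw [← ENNReal.ofReal_coe_nnreal (p := η)]
    exact ENNReal.ofReal_le_ofReal (min_le_left _ _)
  refine ⟨|a| / η + |b|, fun x hx => leastConcaveMajorant_le
    (concaveOn_line ε _ _ (convex_Ioi 0)) (fun y hy => ?_) hx⟩
  have hy' : 0 < y := hy
  rcases lt_or_ge y η with hyη | hyη
  · have h1 : primitive u y ≤ ENNReal.ofReal ε := by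
      have := hd (Ioo 0 y) (lt_of_le_of_lt (Measure.restrict_apply_le _ _) (lt_of_le_of_lt (by
        rw [Real.volume_Ioo, sub_zero]; exact ENNReal.ofReal_le_ofReal hyη.le) hηδ.2))
      rw [Measure.restrict_restrict measurableSet_Ioo,
        inter_eq_left.2 (Ioo_subset_Ioo le_rfl (hyη.le.trans hηδ.1))] at this
      exact this.le
    have h2 := ENNReal.toReal_mono ENNReal.ofReal_ne_top h1
    rw [ENNReal.toReal_ofReal hε.le] at h2
    have : 0 ≤ (|a| / η + |b|) * y := by positivity
    linarith
  · have h1 := (h y hy').2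
    have h2 : |a| ≤ |a| / η * y := by
      rw [div_mul_eq_mul_div, le_div_iff₀ hη]
      exact mul_le_mul_of_nonneg_left hyη (abs_nonneg a)
    have h3 := le_abs_self a
    have h4 := mul_le_mul_of_nonneg_right (le_abs_self b) hy'.le
    nlinarith

theorem LorentzSeries.UnderLine.leastConcaveMajorant_nonneg (hu : UnderLine u) (x : ℝ)
    (hx : 0 < x) : 0 ≤ leastConcaveMajorant (fun y => (primitive u y).toReal) x :=
  ENNReal.toReal_nonneg.trans (le_leastConcaveMajorant hu.exists_concave hx)

theorem LorentzSeries.UnderLine.antitoneOn_levelFunction₀ (hu : UnderLine u) :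
    AntitoneOn (levelFunction₀ u) (Ioi 0) := fun _ hx _ hy hxy =>
  ENNReal.ofReal_le_ofReal
    ((concaveOn_leastConcaveMajorant hu.exists_concave).antitoneOn_rightDeriv hx hy hxy)

theorem LorentzSeries.UnderLine.lintegral_levelFunction₀ (hu : UnderLine u) {x : ℝ} (hx : 0 < x) :
    ∫⁻ t in Ioo 0 x, levelFunction₀ u t =
      ENNReal.ofReal (leastConcaveMajorant (fun y => (primitive u y).toReal) x) :=
  (concaveOn_leastConcaveMajorant hu.exists_concave).lintegral_rightDeriv
    hu.leastConcaveMajorant_nonneg hu.leastConcaveMajorant_le_line hx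

theorem LorentzSeries.UnderLine.lintegral_le_levelFunction₀ (hu : UnderLine u) {x : ℝ}
    (hx : 0 < x) : ∫⁻ t in Ioo 0 x, u t ≤ ∫⁻ t in Ioo 0 x, levelFunction₀ u t := by
  rw [hu.lintegral_levelFunction₀ hx]
  obtain ⟨a, b, h⟩ := id hu
  refine le_trans (le_of_eq (ENNReal.ofReal_toReal (h x hx).1).symm)
    (ENNReal.ofReal_le_ofReal (le_leastConcaveMajorant hu.exists_concave hx))

end LevelFunction

/-! ### Averaging operators -/

/-- `A` is the averaging operator of the family `S` of intervals, encoded by their endpoints. -/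
def IsAveraging (S : Set (ℝ × ℝ)) (A : (ℝ → ℝ≥0∞) → ℝ → ℝ≥0∞) : Prop :=
  (∀ I ∈ S, 0 ≤ I.1 ∧ I.1 < I.2) ∧ S.PairwiseDisjoint (fun I => Ioo I.1 I.2) ∧
    ∀ f : ℝ → ℝ≥0∞,
      (∀ I ∈ S, ∀ x ∈ Ioo I.1 I.2,
        A f x = (ENNReal.ofReal (I.2 - I.1))⁻¹ * ∫⁻ t in Ioo I.1 I.2, f t) ∧
      (∀ x, (∀ I ∈ S, x ∉ Ioo I.1 I.2) → A f x = f x)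

theorem exists_isAveraging {S : Set (ℝ × ℝ)} (h1 : ∀ I ∈ S, 0 ≤ I.1 ∧ I.1 < I.2)
    (h2 : S.PairwiseDisjoint (fun I => Ioo I.1 I.2)) : ∃ A, IsAveraging S A := by
  classical
  refine ⟨fun f x => if h : ∃ I ∈ S, x ∈ Ioo I.1 I.2 then
    (ENNReal.ofReal (h.choose.2 - h.choose.1))⁻¹ * ∫⁻ t in Ioo h.choose.1 h.choose.2, f t
    else f x, h1, h2, fun f => ⟨fun I hI x hx => ?_, fun x hx => ?_⟩⟩
  · have h : ∃ I ∈ S, x ∈ Ioo I.1 I.2 := ⟨I, hI, hx⟩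
    have he : h.choose = I := h2.elim_set h.choose_spec.1 hI x h.choose_spec.2 hx
    simp only [dif_pos h, he]
  · exact dif_neg (by rintro ⟨I, hI, h⟩; exact hx I hI h)

theorem average_const {a b : ℝ} (hab : a < b) (c : ℝ≥0∞) :
    (ENNReal.ofReal (b - a))⁻¹ * ∫⁻ _ in Ioo a b, c = c := by
  rw [setLIntegral_const, Real.volume_Ioo, mul_comm c, ← mul_assoc,
    ENNReal.inv_mul_cancel (by simpa using hab) ENNReal.ofReal_ne_top, one_mul]

theorem average_le {a b : ℝ} (hab : a < b) {f : ℝ → ℝ≥0∞} {c : ℝ≥0∞}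
    (h : ∀ t ∈ Ioo a b, f t ≤ c) : (ENNReal.ofReal (b - a))⁻¹ * ∫⁻ t in Ioo a b, f t ≤ c :=
  (mul_le_mul_right (setLIntegral_mono' measurableSet_Ioo h) _).trans (average_const hab c).le

theorem le_average {a b : ℝ} (hab : a < b) {f : ℝ → ℝ≥0∞} {c : ℝ≥0∞}
    (h : ∀ t ∈ Ioo a b, c ≤ f t) : c ≤ (ENNReal.ofReal (b - a))⁻¹ * ∫⁻ t in Ioo a b, f t :=
  (average_const hab c).ge.trans (mul_le_mul_right (setLIntegral_mono' measurableSet_Ioo h) _)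

namespace IsAveraging

variable {S : Set (ℝ × ℝ)} {A : (ℝ → ℝ≥0∞) → ℝ → ℝ≥0∞}

theorem countable (hA : IsAveraging S A) : S.Countable :=
  hA.2.1.countable_of_isOpen (fun _ _ => isOpen_Ioo) fun I hI => nonempty_Ioo.2 (hA.1 I hI).2

theorem apply_eq (hA : IsAveraging S A) (f : ℝ → ℝ≥0∞) {I : ℝ × ℝ} (hI : I ∈ S) {x : ℝ}
    (hx : x ∈ Ioo I.1 I.2) :
    A f x = (ENNReal.ofReal (I.2 - I.1))⁻¹ * ∫⁻ t in Ioo I.1 I.2, f t :=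
  (hA.2.2 f).1 I hI x hx

theorem apply_of_notMem (hA : IsAveraging S A) (f : ℝ → ℝ≥0∞) {x : ℝ}
    (hx : ¬ ∃ I ∈ S, x ∈ Ioo I.1 I.2) : A f x = f x :=
  (hA.2.2 f).2 x fun I hI h => hx ⟨I, hI, h⟩

theorem Ioo_subset (hA : IsAveraging S A) {I : ℝ × ℝ} (hI : I ∈ S) : Ioo I.1 I.2 ⊆ Ioi 0 :=
  fun _ hx => (hA.1 I hI).1.trans_lt hx.1

/-- The half line is the union of the intervals of the family and a rest. -/
theorem lintegral_split (hA : IsAveraging S A) (F : ℝ → ℝ≥0∞) :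
    ∫⁻ t in Ioi (0 : ℝ), F t = (∑' I : S, ∫⁻ t in Ioo I.1.1 I.1.2, F t) +
      ∫⁻ t in Ioi 0 \ ⋃ I ∈ S, Ioo I.1 I.2, F t := by
  have hm : MeasurableSet (⋃ I ∈ S, Ioo I.1 I.2) :=
    MeasurableSet.biUnion hA.countable fun _ _ => measurableSet_Ioo
  rw [← lintegral_biUnion hA.countable (fun _ _ => measurableSet_Ioo) hA.2.1,
    ← lintegral_inter_add_sdiff F (Ioi 0) hm,
    inter_eq_right.2 (show ⋃ I ∈ S, Ioo I.1 I.2 ⊆ Ioi 0 from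
      iUnion₂_subset fun I hI => hA.Ioo_subset hI)]

/-- Averaging operators are symmetric. -/
theorem lintegral_symm (hA : IsAveraging S A) {f g : ℝ → ℝ≥0∞}
    (hf : AEMeasurable f (volume.restrict (Ioi 0)))
    (hg : AEMeasurable g (volume.restrict (Ioi 0))) :
    ∫⁻ t in Ioi (0 : ℝ), A f t * g t = ∫⁻ t in Ioi (0 : ℝ), f t * A g t := by
  rw [hA.lintegral_split, hA.lintegral_split]
  have hm : MeasurableSet (⋃ I ∈ S, Ioo I.1 I.2) :=
    MeasurableSet.biUnion hA.countable fun _ _ => measurableSet_Ioo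
  congr 1
  · refine tsum_congr fun I => ?_
    rw [setLIntegral_congr_fun measurableSet_Ioo fun t ht => congrArg (· * g t)
        (hA.apply_eq f I.2 ht),
      setLIntegral_congr_fun measurableSet_Ioo fun t ht => congrArg (f t * ·)
        (hA.apply_eq g I.2 ht),
      lintegral_const_mul'' _ (hg.mono_set (hA.Ioo_subset I.2)),
      lintegral_mul_const'' _ (hf.mono_set (hA.Ioo_subset I.2))]
    ring
  · refine setLIntegral_congr_fun (measurableSet_Ioi.diff hm) fun t ht => ?_
    have : ¬ ∃ I ∈ S, t ∈ Ioo I.1 I.2 := fun ⟨I, hI, h⟩ =>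
      ht.2 (mem_biUnion (t := fun I : ℝ × ℝ => Ioo I.1 I.2) hI h)
    simp only [hA.apply_of_notMem _ this]

theorem le_of_le (hA : IsAveraging S A) {f : ℝ → ℝ≥0∞} {c : ℝ≥0∞} (h : ∀ t, 0 < t → f t ≤ c)
    {x : ℝ} (hx : 0 < x) : A f x ≤ c := by
  by_cases hI : ∃ I ∈ S, x ∈ Ioo I.1 I.2
  · obtain ⟨I, hI, hxI⟩ := hI
    rw [hA.apply_eq f hI hxI]
    exact average_le (hA.1 I hI).2 fun t ht => h t (hA.Ioo_subset hI ht)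
  · rw [hA.apply_of_notMem f hI]
    exact h x hx

theorem mono (hA : IsAveraging S A) {f g : ℝ → ℝ≥0∞} (h : ∀ t, 0 < t → f t ≤ g t)
    {x : ℝ} (hx : 0 < x) : A f x ≤ A g x := by
  by_cases hI : ∃ I ∈ S, x ∈ Ioo I.1 I.2
  · obtain ⟨I, hI, hxI⟩ := hI
    rw [hA.apply_eq f hI hxI, hA.apply_eq g hI hxI]
    exact mul_le_mul_right
      (setLIntegral_mono' measurableSet_Ioo fun t ht => h t (hA.Ioo_subset hI ht)) _
  · rw [hA.apply_of_notMem f hI, hA.apply_of_notMem g hI]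
    exact h x hx

theorem antitoneOn (hA : IsAveraging S A) {f : ℝ → ℝ≥0∞} (hf : AntitoneOn f (Ioi 0)) :
    AntitoneOn (A f) (Ioi 0) := by
  intro x hx y hy hxy
  have hx' : 0 < x := hx
  have hy' : 0 < y := hy
  -- a point separating the intervals that contain `x` and `y` carries an intermediate value
  have up : ∀ s t, 0 < s → s ≤ t → (∀ I ∈ S, t ∈ Ioo I.1 I.2 → s ≤ I.1) → A f t ≤ f s := by
    intro s t hs hst h
    by_cases hI : ∃ I ∈ S, t ∈ Ioo I.1 I.2
    · obtain ⟨I, hI, ht⟩ := hI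
      rw [hA.apply_eq f hI ht]
      have h1 := h I hI ht
      exact average_le (hA.1 I hI).2 fun r hr => hf hs (hA.Ioo_subset hI hr) (h1.trans hr.1.le)
    · rw [hA.apply_of_notMem f hI]
      exact hf hs (hs.trans_le hst) hst
  by_cases hI : ∃ I ∈ S, x ∈ Ioo I.1 I.2
  · obtain ⟨I, hI, hxI⟩ := hI
    rcases lt_or_ge y I.2 with hyI | hyI
    · rw [hA.apply_eq f hI hxI, hA.apply_eq f hI ⟨hxI.1.trans_le hxy, hyI⟩]
    · have h2 : 0 < I.2 := (hA.1 I hI).1.trans_lt (hA.1 I hI).2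
      refine (up I.2 y h2 hyI fun J hJ hyJ => ?_).trans ?_
      · by_contra! hc
        have he := hA.2.1.elim_set hI hJ ((max I.1 J.1 + I.2) / 2)
          ⟨by linarith [le_max_left I.1 J.1, max_lt (hA.1 I hI).2 hc],
            by linarith [max_lt (hA.1 I hI).2 hc]⟩
          ⟨by linarith [le_max_right I.1 J.1, max_lt (hA.1 I hI).2 hc],
            by linarith [max_lt (hA.1 I hI).2 hc, hyJ.2]⟩
        rw [← he] at hyJ
        exact absurd hyJ.2 (not_lt.2 hyI)
      · rw [hA.apply_eq f hI hxI]
        exact le_average (hA.1 I hI).2 fun r hr => hf (hA.Ioo_subset hI hr) h2 hr.2.le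
  · rw [hA.apply_of_notMem f hI]
    by_cases h : ∃ J ∈ S, y ∈ Ioo J.1 J.2 ∧ J.1 < x
    · obtain ⟨J, hJ, hyJ, hJx⟩ := h
      exact absurd ⟨J, hJ, hJx, hxy.trans_lt hyJ.2⟩ hI
    · exact up x y hx' hxy fun J hJ hyJ => not_lt.1 fun hc => h ⟨J, hJ, hyJ, hc⟩

theorem lintegral_Ioo_eq (hA : IsAveraging S A) {f : ℝ → ℝ≥0∞}
    (hf : AEMeasurable f (volume.restrict (Ioi 0))) {a : ℝ} (ha : ¬ ∃ I ∈ S, a ∈ Ioo I.1 I.2) :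
    ∫⁻ t in Ioo 0 a, A f t = ∫⁻ t in Ioo 0 a, f t := by
  have h := hA.lintegral_symm hf
    ((measurable_const (a := (1 : ℝ≥0∞))).indicator
      (measurableSet_Ioo (a := 0) (b := a))).aemeasurable
  have hφ : ∀ t, 0 < t → A ((Ioo 0 a).indicator fun _ => 1) t =
      (Ioo 0 a).indicator (fun _ => 1) t := by
    intro t ht
    by_cases hI : ∃ I ∈ S, t ∈ Ioo I.1 I.2
    · obtain ⟨I, hI, htI⟩ := hI
      have hconst : ∀ s ∈ Ioo I.1 I.2, (Ioo 0 a).indicator (fun _ => (1 : ℝ≥0∞)) s =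
          (Ioo 0 a).indicator (fun _ => 1) t := by
        intro s hs
        have hiff : s < a ↔ t < a := by
          by_contra hc
          refine ha ⟨I, hI, ?_⟩
          rcases lt_or_ge s a with h1 | h1 <;> rcases lt_or_ge t a with h2 | h2
          · simp [h1, h2] at hc
          · exact ⟨hs.1.trans h1, h2.trans_lt htI.2⟩
          · exact ⟨htI.1.trans h2, h1.trans_lt hs.2⟩
          · simp [h1.not_gt, h2.not_gt] at hc
        have hs0 : 0 < s := hA.Ioo_subset hI hs
        simp [indicator_apply, hs0, ht, hiff]
      rw [hA.apply_eq _ hI htI]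
      exact le_antisymm (average_le (hA.1 I hI).2 fun s hs => (hconst s hs).le)
        (le_average (hA.1 I hI).2 fun s hs => (hconst s hs).ge)
    · exact hA.apply_of_notMem _ hI
  have e : ∀ F : ℝ → ℝ≥0∞, ∫⁻ t in Ioi (0 : ℝ), F t * (Ioo 0 a).indicator (fun _ => 1) t =
      ∫⁻ t in Ioo 0 a, F t := by
    intro F
    have : (fun t => F t * (Ioo 0 a).indicator (fun _ => 1) t) = (Ioo 0 a).indicator F := by
      ext t; by_cases ht : t ∈ Ioo 0 a <;> simp [ht]
    rw [this, lintegral_indicator measurableSet_Ioo, Measure.restrict_restrict measurableSet_Ioo,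
      inter_eq_left.2 Ioo_subset_Ioi_self]
  rw [e, setLIntegral_congr_fun (g := fun t => f t * (Ioo 0 a).indicator (fun _ => 1) t)
    measurableSet_Ioi (fun t ht => by simp only [hφ t ht]), e] at h
  exact h

/-- On an interval of the family cut at `x`, the mean of a decreasing function over the whole
interval is at most its mean over the part below `x`. -/
theorem lintegral_Ioo_le (hA : IsAveraging S A) {f : ℝ → ℝ≥0∞} (hf : AntitoneOn f (Ioi 0)) (x : ℝ) :
    ∫⁻ t in Ioo 0 x, A f t ≤ ∫⁻ t in Ioo 0 x, f t := by
  by_cases hI : ∃ I ∈ S, x ∈ Ioo I.1 I.2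
  swap
  · exact (hA.lintegral_Ioo_eq (measurable_of_antitoneOn hf) hI).le
  obtain ⟨I, hI, hxI⟩ := hI
  have h0 := (hA.1 I hI).1
  have hx0 : 0 < x := h0.trans_lt hxI.1
  have ha : ¬ ∃ J ∈ S, I.1 ∈ Ioo J.1 J.2 := by
    rintro ⟨J, hJ, h⟩
    have hlt : I.1 < min I.2 J.2 := lt_min (hA.1 I hI).2 h.2
    have he := hA.2.1.elim_set hI hJ ((I.1 + min I.2 J.2) / 2)
      ⟨by linarith, by linarith [min_le_left I.2 J.2]⟩
      ⟨by linarith [h.1], by linarith [min_le_right I.2 J.2]⟩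
    rw [← he] at h
    exact lt_irrefl _ h.1
  have hsplit : ∀ F : ℝ → ℝ≥0∞, ∀ a b c : ℝ, a ≤ b → b < c →
      ∫⁻ t in Ioo a c, F t = (∫⁻ t in Ioo a b, F t) + ∫⁻ t in Ioo b c, F t := by
    intro F a b c hab hbc
    rw [← Ioc_union_Ioo_eq_Ioo hab hbc, lintegral_union measurableSet_Ioo
      (Set.disjoint_left.2 fun t (h1 : t ∈ Ioc a b) (h2 : t ∈ Ioo b c) => h2.1.not_ge h1.2),
      setLIntegral_congr (Ioo_ae_eq_Ioc (a := a) (b := b)).symm]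
  rw [hsplit _ 0 I.1 x h0 hxI.1, hsplit _ 0 I.1 x h0 hxI.1,
    hA.lintegral_Ioo_eq (measurable_of_antitoneOn hf) ha]
  refine add_le_add le_rfl ?_
  rw [setLIntegral_congr_fun measurableSet_Ioo
    (fun t ht => hA.apply_eq f hI ⟨ht.1, ht.2.trans hxI.2⟩), setLIntegral_const, Real.volume_Ioo]
  set X := ENNReal.ofReal (x - I.1)
  set Y := ENNReal.ofReal (I.2 - x)
  have hXY : ENNReal.ofReal (I.2 - I.1) = X + Y := by
    rw [← ENNReal.ofReal_add (by linarith [hxI.1]) (by linarith [hxI.2])]; ring_nf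
  rw [hsplit f I.1 x I.2 hxI.1.le hxI.2, hXY]
  set P := ∫⁻ t in Ioo I.1 x, f t
  set Q := ∫⁻ t in Ioo x I.2, f t
  have hQ : Q ≤ f x * Y := by
    refine (setLIntegral_mono' (g := fun _ => f x) measurableSet_Ioo fun t ht =>
      hf hx0 (hx0.trans ht.1) ht.1.le).trans (by rw [setLIntegral_const, Real.volume_Ioo])
  have hP : f x * X ≤ P := by
    refine le_trans (by rw [setLIntegral_const, Real.volume_Ioo])
      (setLIntegral_mono' (f := fun _ => f x) measurableSet_Ioo
        fun t ht => hf (h0.trans_lt ht.1) hx0 ht.2.le)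
  have hX : 0 < X := ENNReal.ofReal_pos.2 (by linarith [hxI.1])
  calc (X + Y)⁻¹ * (P + Q) * X = (X + Y)⁻¹ * (P * X + Q * X) := by ring
    _ ≤ (X + Y)⁻¹ * (P * X + P * Y) := by
        refine mul_le_mul_right (add_le_add le_rfl ?_) _
        calc Q * X ≤ f x * Y * X := mul_le_mul_left hQ _
          _ = f x * X * Y := by ring
          _ ≤ P * Y := mul_le_mul_left hP _
    _ = (X + Y)⁻¹ * (X + Y) * P := by ring
    _ = P := by
        rw [ENNReal.inv_mul_cancel (by simp [hX.ne']) (by finiteness), one_mul]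

end IsAveraging

/-! ### Level intervals -/

theorem ConcaveOn.le_chord_left {f : ℝ → ℝ} {s : Set ℝ} (hf : ConcaveOn ℝ s f) {t a b : ℝ}
    (ht : t ∈ s) (hb : b ∈ s) (hta : t < a) (hab : a < b) :
    f t ≤ f a + (f b - f a) / (b - a) * (t - a) := by
  have h := hf.slope_anti_adjacent ht hb hta hab
  rw [le_div_iff₀ (by linarith)] at h
  linarith

theorem ConcaveOn.le_chord_right {f : ℝ → ℝ} {s : Set ℝ} (hf : ConcaveOn ℝ s f) {t a b : ℝ}
    (ha : a ∈ s) (ht : t ∈ s) (hab : a < b) (hbt : b < t) :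
    f t ≤ f a + (f b - f a) / (b - a) * (t - a) := by
  have h := hf.slope_anti_adjacent ha ht hab hbt
  rw [div_le_iff₀ (by linarith)] at h
  have : (f b - f a) / (b - a) * (b - a) = f b - f a := by
    rw [div_mul_cancel₀]; linarith
  linarith

theorem ConcaveOn.chord_le {f : ℝ → ℝ} {s : Set ℝ} (hf : ConcaveOn ℝ s f) {t a b : ℝ}
    (ha : a ∈ s) (hb : b ∈ s) (hat : a ≤ t) (htb : t ≤ b) (hab : a < b) :
    f a + (f b - f a) / (b - a) * (t - a) ≤ f t := by
  rcases hat.eq_or_lt with rfl | hat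
  · simp
  rcases htb.eq_or_lt with rfl | htb
  · rw [div_mul_cancel₀ _ (by linarith)]; linarith
  have h := hf.slope_anti_adjacent ha hb hat htb
  rw [div_le_div_iff₀ (by linarith) (by linarith)] at h
  rw [← le_sub_iff_add_le', div_mul_eq_mul_div, div_le_iff₀ (by linarith)]
  linarith

/-- On an interval whose endpoints are contact points and whose interior is free of them, the least
concave majorant is a chord: otherwise, cutting it off along the lowest parallel of the chord that
still lies above `U` would give a smaller concave majorant. -/
theorem leastConcaveMajorant_eq_chord {U : ℝ → ℝ}
    (hL : ConcaveOn ℝ (Ici 0) ((Ioi 0).indicator (leastConcaveMajorant U)))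
    (hUc : ContinuousOn U (Ici 0))
    (hUL : ∀ x, 0 ≤ x → U x ≤ (Ioi 0).indicator (leastConcaveMajorant U) x) {a b : ℝ} (ha : 0 ≤ a)
    (hab : a < b) (hUa : (Ioi 0).indicator (leastConcaveMajorant U) a = U a)
    (hUb : (Ioi 0).indicator (leastConcaveMajorant U) b = U b)
    (hlt : ∀ x ∈ Ioo a b, U x < (Ioi 0).indicator (leastConcaveMajorant U) x) {t : ℝ}
    (ht : t ∈ Ioo a b) :
    leastConcaveMajorant U t = U a + (U b - U a) / (b - a) * (t - a) := by
  set Lb := (Ioi 0).indicator (leastConcaveMajorant U) with hLb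
  have ha' : a ∈ Ici (0 : ℝ) := ha
  have hb' : b ∈ Ici (0 : ℝ) := ha.trans hab.le
  have hLt : Lb t = leastConcaveMajorant U t := by
    rw [hLb, indicator_of_mem (mem_Ioi.2 (ha.trans_lt ht.1))]
  have hge := hL.chord_le ha' hb' ht.1.le ht.2.le hab
  rw [hUa, hUb, hLt] at hge
  refine le_antisymm ?_ hge
  set l : ℝ → ℝ := fun x => U a + (U b - U a) / (b - a) * (x - a) with hl
  have hla : l a = U a := by simp [hl]
  have hlb : l b = U b := by
    simp only [hl]; rw [div_mul_cancel₀ _ (by linarith)]; linarith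
  have hlc : Continuous l := by fun_prop
  have hsub : Icc a b ⊆ Ici 0 := fun x hx => ha.trans hx.1
  obtain ⟨x₀, hx₀, hmax⟩ := isCompact_Icc.exists_isMaxOn (nonempty_Icc.2 hab.le)
    ((hUc.mono hsub).sub hlc.continuousOn)
  set m := U x₀ - l x₀ with hm
  have hm0 : 0 ≤ m := by
    have : U a - l a ≤ m := hmax (left_mem_Icc.2 hab.le)
    rwa [hla, sub_self] at this
  have hconc : ConcaveOn ℝ (Ioi 0) fun x => U a - (U b - U a) / (b - a) * a + m +
      (U b - U a) / (b - a) * x := concaveOn_line _ _ _ (convex_Ioi 0)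
  have hG := (hL.subset Ioi_subset_Ici_self (convex_Ioi 0)).inf hconc
  have hle : ∀ x, 0 < x → leastConcaveMajorant U x ≤ l x + m := by
    intro x hx
    refine (leastConcaveMajorant_le hG (fun y hy => le_inf (hUL y (le_of_lt hy)) ?_) hx).trans
      (inf_le_right.trans (le_of_eq (by simp only [hl]; ring)))
    have hy0 : (0 : ℝ) ≤ y := le_of_lt hy
    suffices U y ≤ l y + m by
      refine this.trans (le_of_eq (by simp only [hl]; ring))
    rcases lt_or_ge y a with h1 | h1
    · have := hL.le_chord_left hy0 hb' h1 hab
      rw [hUa, hUb] at this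
      linarith [hUL y hy0]
    rcases le_or_gt y b with h2 | h2
    · have : U y - l y ≤ m := hmax (mem_Icc.2 ⟨h1, h2⟩)
      linarith
    · have := hL.le_chord_right ha' hy0 hab h2
      rw [hUa, hUb] at this
      linarith [hUL y hy0]
  have hm' : m = 0 := by
    rcases hx₀.1.eq_or_lt with h | h1
    · rw [hm, ← h, hla, sub_self]
    rcases hx₀.2.eq_or_lt with h | h2
    · rw [hm, h, hlb, sub_self]
    have h3 := hlt x₀ ⟨h1, h2⟩
    have h4 := hle x₀ (ha.trans_lt h1)
    rw [hLb, indicator_of_mem (mem_Ioi.2 (ha.trans_lt h1))] at h3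
    linarith
  have := hle t (ha.trans_lt ht.1)
  rwa [hm', add_zero] at this

/-- The components of the set where a function is positive, bounded by its zeros. -/
theorem exists_zero_free_interval {D : ℝ → ℝ} (hc : ContinuousOn D (Ici 0))
    (hD : ∀ x, 0 ≤ x → 0 ≤ D x)
    (h0 : D 0 = 0) {n : ℝ} (hn : ∀ x, n ≤ x → D x = 0) {x : ℝ} (hx : 0 < x) (hDx : 0 < D x) :
    ∃ a b, 0 ≤ a ∧ x ∈ Ioo a b ∧ D a = 0 ∧ D b = 0 ∧ ∀ y ∈ Ioo a b, 0 < D y := by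
  have hxn : x < n := by
    by_contra! h
    exact hDx.ne' (hn x h)
  have comp : ∀ c d : ℝ, 0 ≤ c → IsCompact {y ∈ Icc c d | D y = 0} := by
    intro c d hc0
    refine isCompact_Icc.of_isClosed_subset ?_ (fun y hy => hy.1)
    exact ((hc.mono fun y hy => hc0.trans hy.1).preimage_isClosed_of_isClosed isClosed_Icc
      (isClosed_singleton (x := (0 : ℝ))))
  obtain ⟨a, ha, hamax⟩ := (comp 0 x le_rfl).exists_isGreatest ⟨0, ⟨le_rfl, hx.le⟩, h0⟩
  obtain ⟨b, hb, hbmin⟩ := (comp x n hx.le).exists_isLeast ⟨n, ⟨hxn.le, le_rfl⟩, hn n le_rfl⟩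
  have hax : a < x := lt_of_le_of_ne ha.1.2 fun h => hDx.ne' (h ▸ ha.2)
  have hxb : x < b := lt_of_le_of_ne hb.1.1 fun h => hDx.ne' (h ▸ hb.2)
  refine ⟨a, b, ha.1.1, ⟨hax, hxb⟩, ha.2, hb.2, fun y hy => ?_⟩
  have hy0 : 0 ≤ y := ha.1.1.trans hy.1.le
  refine lt_of_le_of_ne (hD y hy0) fun h => ?_
  rcases le_total y x with hyx | hyx
  · exact (hamax ⟨⟨hy0, hyx⟩, h.symm⟩).not_gt hy.1
  · exact (hbmin ⟨⟨hyx, hy.2.le.trans hb.1.2⟩, h.symm⟩).not_gt hy.2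

theorem pairwiseDisjoint_zero_free (D : ℝ → ℝ) :
    {I : ℝ × ℝ | 0 ≤ I.1 ∧ I.1 < I.2 ∧ D I.1 = 0 ∧ D I.2 = 0 ∧
      ∀ y ∈ Ioo I.1 I.2, 0 < D y}.PairwiseDisjoint (fun I => Ioo I.1 I.2) := by
  intro I hI J hJ hne
  refine Set.disjoint_left.2 fun t (hI' : t ∈ Ioo I.1 I.2) (hJ' : t ∈ Ioo J.1 J.2) => hne ?_
  obtain ⟨-, -, h1, h2, h3⟩ := hI
  obtain ⟨-, -, k1, k2, k3⟩ := hJ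
  refine Prod.ext (le_antisymm ?_ ?_) (le_antisymm ?_ ?_)
  · exact not_lt.1 fun h => (k3 _ ⟨h, hI'.1.trans hJ'.2⟩).ne' h1
  · exact not_lt.1 fun h => (h3 _ ⟨h, hJ'.1.trans hI'.2⟩).ne' k1
  · exact not_lt.1 fun h => (h3 _ ⟨hI'.1.trans hJ'.2, h⟩).ne' k2
  · exact not_lt.1 fun h => (k3 _ ⟨hJ'.1.trans hI'.2, h⟩).ne' h2

/-- The level function of a bounded function of bounded support is the image of that function under
the averaging operator of its level intervals. -/
theorem exists_isAveraging_eq_levelFunction₀ {φ : ℝ → ℝ≥0∞}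
    (hφ : AEMeasurable φ (volume.restrict (Ioi 0))) {M : ℝ≥0} (hM : ∀ t, 0 < t → φ t ≤ M) {n : ℝ}
    (hn : 0 < n) (hsupp : ∀ t, n ≤ t → φ t = 0) :
    UnderLine φ ∧ ∃ S A, IsAveraging S A ∧
      ∀ᵐ t ∂volume.restrict (Ioi 0), levelFunction₀ φ t = A φ t := by
  have hint : ∫⁻ t in Ioi (0 : ℝ), φ t ≠ ∞ := by
    refine ne_top_of_le_ne_top
      (b := ∫⁻ t in Ioi (0 : ℝ), (Ioo 0 n).indicator (fun _ => (M : ℝ≥0∞)) t)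
      ?_ (setLIntegral_mono' measurableSet_Ioi fun t ht => ?_)
    · rw [lintegral_indicator measurableSet_Ioo, setLIntegral_const]
      refine ENNReal.mul_ne_top ENNReal.coe_ne_top
        (ne_top_of_le_ne_top ?_ (Measure.restrict_apply_le _ _))
      simp
    · rcases lt_or_ge t n with h | h
      · rw [indicator_of_mem (mem_Ioo.2 ⟨ht, h⟩)]; exact hM t ht
      · rw [hsupp t h]; exact zero_le
  have hprim : ∀ x, primitive φ x ≠ ∞ := fun x =>
    ne_top_of_le_ne_top hint (lintegral_mono_set Ioo_subset_Ioi_self)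
  set U : ℝ → ℝ := fun x => (primitive φ x).toReal with hUdef
  have hU0 : U 0 = 0 := by simp [hUdef, primitive]
  have hUmax : ∀ x, U x ≤ (∫⁻ t in Ioi (0 : ℝ), φ t).toReal := fun x =>
    ENNReal.toReal_mono hint (lintegral_mono_set Ioo_subset_Ioi_self)
  have hline : UnderLine φ := ⟨_, 0, fun x _ => ⟨hprim x, (hUmax x).trans (by simp; rfl)⟩⟩
  refine ⟨hline, ?_⟩
  -- the primitive as an interval integral of a function on the line
  set φ' : ℝ → ℝ := (Ioi 0).indicator fun t => (φ t).toReal with hφ'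
  have hφi : Integrable φ' :=
    (integrable_indicator_iff measurableSet_Ioi).2 (integrable_toReal_of_lintegral_ne_top hφ hint)
  have hUint : ∀ x, 0 ≤ x → U x = ∫ t in (0 : ℝ)..x, φ' t := by
    intro x hx
    rw [intervalIntegral.integral_of_le hx, integral_Ioc_eq_integral_Ioo, hφ',
      setIntegral_indicator measurableSet_Ioi, inter_eq_left.2 Ioo_subset_Ioi_self, integral_toReal]
    · rfl
    · exact hφ.mono_set Ioo_subset_Ioi_self
    · refine (ae_restrict_iff' measurableSet_Ioo).2 (Filter.Eventually.of_forall fun t ht => ?_)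
      exact (hM t ht.1).trans_lt ENNReal.coe_lt_top
  have hUc : ContinuousOn U (Ici 0) :=
    (intervalIntegral.continuous_primitive (fun a b => hφi.intervalIntegrable) 0).continuousOn.congr
      fun x hx => hUint x hx
  have hUdiff : ∀ a b, 0 ≤ a → a < b →
      ENNReal.ofReal (U b - U a) = ∫⁻ t in Ioo a b, φ t := by
    intro a b ha hab
    have : primitive φ b = primitive φ a + ∫⁻ t in Ioo a b, φ t := by
      rw [primitive, primitive, ← Ioc_union_Ioo_eq_Ioo ha hab, lintegral_union measurableSet_Ioo
        (Set.disjoint_left.2 fun t (h1 : t ∈ Ioc 0 a) (h2 : t ∈ Ioo a b) => h2.1.not_ge h1.2),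
        setLIntegral_congr (Ioo_ae_eq_Ioc (a := 0) (b := a)).symm]
    have hfin : ∫⁻ t in Ioo a b, φ t ≠ ∞ := by
      intro h; rw [h, add_top] at this; exact hprim b this
    simp only [hUdef]
    rw [this, ENNReal.toReal_add (hprim a) hfin, add_sub_cancel_left, ENNReal.ofReal_toReal hfin]
  have hUn : ∀ x, n ≤ x → U x = (∫⁻ t in Ioi (0 : ℝ), φ t).toReal := by
    intro x hx
    have h : ∫⁻ t in Ici x, φ t = 0 := by
      rw [setLIntegral_congr_fun measurableSet_Ici fun t ht => hsupp t (hx.trans ht),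
        lintegral_zero]
    simp only [hUdef, primitive]
    rw [← Ioo_union_Ici_eq_Ioi (hn.trans_le hx), lintegral_union measurableSet_Ici
      (Set.disjoint_left.2 fun t (h1 : t ∈ Ioo 0 x) (h2 : t ∈ Ici x) => h1.2.not_ge h2), h,
      add_zero]
  set L := leastConcaveMajorant U with hLdef
  have hex : ∃ G : ℝ → ℝ, ConcaveOn ℝ (Ioi 0) G ∧ ∀ y ∈ Ioi (0 : ℝ), U y ≤ G y :=
    hline.exists_concave
  have hLconc : ConcaveOn ℝ (Ioi 0) L := concaveOn_leastConcaveMajorant hex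
  have hL0 : ∀ x, 0 < x → 0 ≤ L x := hline.leastConcaveMajorant_nonneg
  have hLbc := hLconc.continuousOn_indicator_Ici hL0 hline.leastConcaveMajorant_le_line
  have hLbconc := hLconc.indicator_Ici hL0
  set Lb := (Ioi 0).indicator L with hLb
  have hLb0 : Lb 0 = 0 := by simp [hLb]
  have hLbpos : ∀ x, 0 < x → Lb x = L x := fun x hx => indicator_of_mem (mem_Ioi.2 hx) L
  have hULb : ∀ x, 0 ≤ x → U x ≤ Lb x := by
    intro x hx
    rcases hx.eq_or_lt with rfl | hx
    · rw [hU0, hLb0]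
    · rw [hLbpos x hx]; exact le_leastConcaveMajorant hex hx
  set D : ℝ → ℝ := fun x => Lb x - U x with hD
  have hDnn : ∀ x, 0 ≤ x → 0 ≤ D x := fun x hx => sub_nonneg.2 (hULb x hx)
  have hDn : ∀ x, n ≤ x → D x = 0 := by
    intro x hx
    refine le_antisymm (sub_nonpos.2 ?_) (hDnn x (hn.le.trans hx))
    rw [hLbpos x (hn.trans_le hx), hUn x hx]
    have := leastConcaveMajorant_le (U := U)
      (concaveOn_line (∫⁻ t in Ioi (0 : ℝ), φ t).toReal 0 _ (convex_Ioi 0))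
      (fun y _ => by simpa using hUmax y) (hn.trans_le hx)
    simpa using this
  set S : Set (ℝ × ℝ) := {I | 0 ≤ I.1 ∧ I.1 < I.2 ∧ D I.1 = 0 ∧ D I.2 = 0 ∧
    ∀ y ∈ Ioo I.1 I.2, 0 < D y} with hS
  obtain ⟨A, hA⟩ := exists_isAveraging (S := S) (fun I hI => ⟨hI.1, hI.2.1⟩)
    (pairwiseDisjoint_zero_free D)
  refine ⟨S, A, hA, ?_⟩
  have hd := (hLconc.monotoneOn_of_nonneg hL0).ae_differentiableWithinAt measurableSet_Ioi
  have hd' := ae_restrict_of_ae (s := Ioi (0 : ℝ))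
    (LocallyIntegrable.ae_hasDerivAt_integral hφi.locallyIntegrable)
  filter_upwards [hd, hd', ae_restrict_mem measurableSet_Ioi] with t hLt hΦt ht
  have ht0 : 0 < t := ht
  change ENNReal.ofReal (derivWithin L (Ioi t) t) = A φ t
  by_cases hI : ∃ I ∈ S, t ∈ Ioo I.1 I.2
  · obtain ⟨⟨a, b⟩, hI, htI⟩ := hI
    obtain ⟨ha, hab, hDa, hDb, hDI⟩ := id hI
    simp only at ha hab hDa hDb hDI htI
    have hchord : ∀ x ∈ Ioo a b, L x = U a + (U b - U a) / (b - a) * (x - a) := fun x hx =>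
      leastConcaveMajorant_eq_chord hLbconc hUc hULb ha hab (sub_eq_zero.1 hDa)
        (sub_eq_zero.1 hDb) (fun y hy => sub_pos.1 (hDI y hy)) hx
    have hder : HasDerivWithinAt L ((U b - U a) / (b - a)) (Ioi t) t := by
      have h1 : HasDerivAt (fun x => U a + (U b - U a) / (b - a) * (x - a))
          ((U b - U a) / (b - a)) t := by
        simpa using
          (((hasDerivAt_id t).sub_const a).const_mul ((U b - U a) / (b - a))).const_add (U a)
      refine (h1.congr_of_eventuallyEq ?_).hasDerivWithinAt
      filter_upwards [isOpen_Ioo.mem_nhds htI] with x hx using hchord x hx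
    rw [hder.derivWithin (uniqueDiffWithinAt_Ioi t), hA.apply_eq φ hI htI, ← hUdiff a b ha hab,
      div_eq_inv_mul, ENNReal.ofReal_mul (inv_nonneg.2 (by linarith)),
      ENNReal.ofReal_inv_of_pos (by linarith)]
  · rw [hA.apply_of_notMem φ hI]
    have hDt : D t = 0 := by
      by_contra hne
      obtain ⟨a, b, ha, htab, h1, h2, h3⟩ := exists_zero_free_interval (hLbc.sub hUc) hDnn
        (by simp [hLb0, hU0]) hDn ht0 (lt_of_le_of_ne (hDnn t ht0.le) (Ne.symm hne))
      exact hI ⟨(a, b), ⟨ha, htab.1.trans htab.2, h1, h2, h3⟩, htab⟩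
    have hLd : DifferentiableAt ℝ L t := hLt.differentiableAt (Ioi_mem_nhds ht0)
    have hUd : HasDerivAt U (φ' t) t := (hΦt 0).congr_of_eventuallyEq (by
      filter_upwards [Ioi_mem_nhds ht0] with x hx using hUint x (le_of_lt hx))
    have hmin : IsLocalMin (fun x => L x - U x) t := by
      filter_upwards [Ioi_mem_nhds ht0] with x hx
      rw [← hLbpos t ht0, ← hLbpos x hx]
      exact hDt.le.trans (hDnn x (le_of_lt hx))
    have h0 := hmin.hasDerivAt_eq_zero (hLd.hasDerivAt.sub hUd)
    rw [hLd.hasDerivAt.hasDerivWithinAt.derivWithin (uniqueDiffWithinAt_Ioi t), sub_eq_zero.1 h0,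
      hφ', indicator_of_mem ht, ENNReal.ofReal_toReal]
    exact ne_top_of_le_ne_top ENNReal.coe_ne_top (hM t ht0)

/-! ### Decreasing rearrangements -/

section Rearrangement

theorem rearr_anti {X E : Type*} [MeasurableSpace X] [ENorm E] (μ : Measure X) (f : X → E) :
    Antitone (rearr μ f) := fun _ _ hst =>
  sInf_le_sInf fun _ hl => ⟨hl.1, hl.2.trans (ENNReal.ofReal_le_ofReal hst)⟩

variable {E : Type*} [ENorm E] {f : ℝ → E}

theorem rearr_le_enorm (hf : AntitoneOn (fun t => ‖f t‖ₑ) (Ioi 0)) {t : ℝ} (ht : 0 < t) :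
    rearr halfLine f t ≤ ‖f t‖ₑ := by
  refine le_of_forall_gt fun l hl => ?_
  obtain ⟨l', h1, h2⟩ := exists_between hl
  refine lt_of_le_of_lt (sInf_le ⟨zero_le.trans_lt h1, ?_⟩) h2
  rw [halfLine, Measure.restrict_apply' measurableSet_Ioi]
  have hsub : {x | l' < ‖f x‖ₑ} ∩ Ioi 0 ⊆ Ioo 0 t := fun x hx =>
    ⟨hx.2, not_le.1 fun htx => (hx.1.trans_le (hf ht hx.2 htx)).not_gt h1⟩
  refine (measure_mono hsub).trans ?_
  rw [Real.volume_Ioo, sub_zero]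

theorem enorm_le_rearr (hf : AntitoneOn (fun t => ‖f t‖ₑ) (Ioi 0)) {s t : ℝ} (ht : 0 < t)
    (hts : t < s) : ‖f s‖ₑ ≤ rearr halfLine f t := by
  refine le_sInf fun l hl => ?_
  by_contra! hc
  have hs : 0 < s := ht.trans hts
  have hsub : Ioc 0 s ⊆ {x | l < ‖f x‖ₑ} ∩ Ioi 0 := fun x hx =>
    ⟨hc.trans_le (hf hx.1 hs hx.2), hx.1⟩
  have hm := hl.2
  rw [halfLine, Measure.restrict_apply' measurableSet_Ioi] at hm
  have h := (measure_mono hsub).trans hm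
  rw [Real.volume_Ioc, sub_zero, ENNReal.ofReal_le_ofReal_iff ht.le] at h
  linarith

theorem ae_enorm_le_rearr (hf : AntitoneOn (fun t => ‖f t‖ₑ) (Ioi 0)) :
    ∀ᵐ t ∂volume.restrict (Ioi 0), ‖f t‖ₑ ≤ rearr halfLine f t := by
  have hc := hf.countable_not_continuousWithinAt
  filter_upwards [ae_restrict_of_ae (hc.ae_notMem volume), ae_restrict_mem measurableSet_Ioi]
    with t ht ht0
  simp only [not_and, not_not] at ht
  have hlim : Filter.Tendsto (fun s => ‖f s‖ₑ) (nhdsWithin t (Ioi t)) (nhds ‖f t‖ₑ) :=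
    (ht ht0).mono (Ioi_subset_Ioi (le_of_lt ht0))
  refine le_of_tendsto hlim ?_
  filter_upwards [self_mem_nhdsWithin] with s hs using enorm_le_rearr hf ht0 hs

end Rearrangement

/-! ### Competitors in the norm of `Θ` -/

section Cone

variable {h : ℝ → ℝ≥0}

theorem antitoneOn_toENN (hh : h ∈ coneP) : AntitoneOn (toENN h) (Ioi 0) := fun _ hx _ hy hxy =>
  ENNReal.coe_le_coe.2 (hh.2.1 hx hy hxy)

theorem exists_bound_of_mem_coneP (hh : h ∈ coneP) : ∃ c : ℝ≥0, ∀ t, 0 < t → toENN h t ≤ c := by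
  obtain ⟨c, hc⟩ := hh.2.2
  refine ⟨c, fun t ht => ENNReal.coe_le_coe.2 ?_⟩
  rcases lt_or_ge t 1 with h1 | h1
  · exact (hc t ⟨ht, h1⟩).le
  · rw [← hc (1 / 2) (by norm_num)]
    exact hh.2.1 (mem_Ioi.2 (by norm_num)) ht (by linarith)

theorem toENN_ne_top (h : ℝ → ℝ≥0) (t : ℝ) : toENN h t ≠ ∞ := ENNReal.coe_ne_top

/-- The decreasing rearrangements that compete in the norm of `Θ`: decreasing functions whose
integrals over the intervals `(0, y)` are dominated by those of `f`. The consequences that `g` is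
bounded by a constant `c` and by the mean of `f` are recorded as fields. -/
structure Majorizes (f g : ℝ → ℝ≥0∞) (c : ℝ≥0) : Prop where
  anti : AntitoneOn g (Ioi 0)
  le_const : ∀ t, 0 < t → g t ≤ c
  lintegral_le : ∀ y, 0 < y → ∫⁻ t in Ioo 0 y, g t ≤ ∫⁻ t in Ioo 0 y, f t
  le_hardyMean : ∀ t, 0 < t → g t ≤ hardyMean f t

theorem hardyMean_le_iff {f g : ℝ → ℝ≥0∞} {t : ℝ} (ht : 0 < t) :
    hardyMean f t ≤ hardyMean g t ↔ ∫⁻ s in Ioo 0 t, f s ≤ ∫⁻ s in Ioo 0 t, g s :=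
  ENNReal.mul_le_mul_iff_right (by simp) (by simpa using ht)

theorem majorizes_rearr (hh : h ∈ coneP) {c : ℝ≥0} (hc : ∀ t, 0 < t → toENN h t ≤ c) {k : ℝ → ℝ}
    (hk : ∀ t : ℝ, 0 < t → rearr2 halfLine k t ≤ rearr2 halfLine (toENN h) t) :
    Majorizes (toENN h) (rearr halfLine k) c := by
  have hint : ∀ y, 0 < y →
      ∫⁻ t in Ioo 0 y, rearr halfLine k t ≤ ∫⁻ t in Ioo 0 y, toENN h t := fun y hy =>
    ((hardyMean_le_iff hy).1 (hk y hy)).trans (setLIntegral_mono' measurableSet_Ioo fun t ht =>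
      rearr_le_enorm (f := toENN h) (antitoneOn_toENN hh) ht.1)
  have hmean : ∀ t, 0 < t → rearr halfLine k t ≤ hardyMean (toENN h) t := by
    intro t ht
    refine le_trans ?_ ((hardyMean_le_iff ht).2 (hint t ht))
    have := le_average ht (f := rearr halfLine k) (c := rearr halfLine k t)
      fun s hs => rearr_anti _ _ hs.2.le
    rwa [sub_zero] at this
  refine ⟨(rearr_anti _ _).antitoneOn _, fun t ht => (hmean t ht).trans ?_, hint, hmean⟩
  have := average_le ht (f := toENN h) (c := c) fun s hs => hc s hs.1
  rwa [sub_zero] at this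

/-- Averages of a function in the cone are competitors in its norm. -/
theorem wnorm_average_le_thetaNorm (hh : h ∈ coneP) {r : ℝ} (hr : 0 < r) (u : ℝ → ℝ≥0∞)
    {A : (ℝ → ℝ≥0∞) → ℝ → ℝ≥0∞} (hA : A ∈ averagingOperators) :
    wnorm r u (A (toENN h)) ≤ thetaNorm halfLine r u (toENN h) := by
  obtain ⟨S, hA⟩ : ∃ S, IsAveraging S A := hA
  obtain ⟨c, hc⟩ := exists_bound_of_mem_coneP hh
  have hanti := antitoneOn_toENN hh
  have hAh := hA.antitoneOn hanti
  set k : ℝ → ℝ := fun t => (A (toENN h) t).toReal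
  have hk : ∀ t, 0 < t → ‖k t‖ₑ = A (toENN h) t := fun t ht => by
    rw [Real.enorm_eq_ofReal ENNReal.toReal_nonneg, ENNReal.ofReal_toReal
      (ne_top_of_le_ne_top ENNReal.coe_ne_top (hA.le_of_le hc ht))]
  have hkanti : AntitoneOn (fun t => ‖k t‖ₑ) (Ioi 0) := fun x hx y hy hxy => by
    simpa only [hk x hx, hk y hy] using hAh hx hy hxy
  have hle : ∀ t : ℝ, 0 < t → rearr2 halfLine k t ≤ rearr2 halfLine (toENN h) t := by
    intro t ht
    refine (hardyMean_le_iff ht).2 ?_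
    calc ∫⁻ s in Ioo 0 t, rearr halfLine k s ≤ ∫⁻ s in Ioo 0 t, A (toENN h) s :=
          setLIntegral_mono' measurableSet_Ioo fun s hs =>
            (rearr_le_enorm hkanti hs.1).trans (hk s hs.1).le
      _ ≤ ∫⁻ s in Ioo 0 t, toENN h s := hA.lintegral_Ioo_le hanti t
      _ ≤ ∫⁻ s in Ioo 0 t, rearr halfLine (toENN h) s :=
          lintegral_mono_ae (ae_restrict_of_ae_restrict_of_subset Ioo_subset_Ioi_self
            (ae_enorm_le_rearr (f := toENN h) hanti))
  refine le_trans ?_ (le_iSup₂_of_le k (measurable_of_antitoneOn hAh).ennreal_toReal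
    (le_iSup_of_le hle le_rfl))
  refine ENNReal.rpow_le_rpow (lintegral_mono_ae ?_) (by positivity)
  filter_upwards [ae_enorm_le_rearr hkanti, ae_restrict_mem measurableSet_Ioi] with t ht ht0
  rw [hk t ht0] at ht
  gcongr

end Cone

/-! ### Truncations -/

section Truncation

variable {u : ℝ → ℝ≥0∞}

theorem aemeasurable_truncation (hu : AEMeasurable u (volume.restrict (Ioi 0))) (n : ℕ) :
    AEMeasurable (truncation n u) (volume.restrict (Ioi 0)) :=
  (hu.min aemeasurable_const).indicator measurableSet_Iio

theorem truncation_le (n : ℕ) (t : ℝ) : truncation n u t ≤ u t := by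
  unfold truncation
  by_cases ht : t ∈ Iio (n : ℝ)
  · rw [indicator_of_mem ht]; exact min_le_left _ _
  · rw [indicator_of_notMem ht]; exact zero_le

theorem truncation_le_nat (n : ℕ) (t : ℝ) : truncation n u t ≤ n := by
  unfold truncation
  by_cases ht : t ∈ Iio (n : ℝ)
  · rw [indicator_of_mem ht]; exact min_le_right _ _
  · rw [indicator_of_notMem ht]; exact zero_le

theorem truncation_eq_zero {n : ℕ} {t : ℝ} (ht : (n : ℝ) ≤ t) : truncation n u t = 0 :=
  indicator_of_notMem (by simpa using ht) _

theorem truncation_mono (t : ℝ) : Monotone fun n => truncation n u t := by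
  intro m n hmn
  have hmn' : (m : ℝ) ≤ n := by exact_mod_cast hmn
  simp only [truncation]
  by_cases ht : t ∈ Iio (m : ℝ)
  · rw [indicator_of_mem ht, indicator_of_mem (Iio_subset_Iio hmn' ht)]
    exact min_le_min le_rfl (by exact_mod_cast hmn)
  · rw [indicator_of_notMem ht]; exact zero_le

theorem iSup_truncation (t : ℝ) : ⨆ n, truncation n u t = u t := by
  refine le_antisymm (iSup_le fun n => truncation_le n t) (le_of_forall_lt fun c hc => ?_)
  obtain ⟨n, hn⟩ := exists_nat_gt t
  obtain ⟨m, hm⟩ := ENNReal.exists_nat_gt hc.ne_top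
  refine lt_of_lt_of_le ?_ (le_iSup _ (max m n))
  have : t ∈ Iio ((max m n : ℕ) : ℝ) := hn.trans_le (by exact_mod_cast le_max_right _ _)
  rw [truncation, indicator_of_mem this]
  exact lt_min hc (hm.trans_le (by exact_mod_cast le_max_left _ _))

theorem lintegral_mul_eq_iSup_truncation {F : ℝ → ℝ≥0∞}
    (hF : AEMeasurable F (volume.restrict (Ioi 0)))
    (hu : AEMeasurable u (volume.restrict (Ioi 0))) :
    ∫⁻ t in Ioi (0 : ℝ), F t * u t = ⨆ n : ℕ, ∫⁻ t in Ioi (0 : ℝ), F t * truncation n u t := by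
  rw [← lintegral_iSup' (f := fun n t => F t * truncation n u t)
      (fun n => hF.mul (aemeasurable_truncation hu n))
    (Filter.Eventually.of_forall fun t m n hmn => mul_le_mul_right (truncation_mono t hmn) _)]
  refine lintegral_congr fun t => ?_
  rw [← ENNReal.mul_iSup, iSup_truncation]

theorem underLine_truncation (n : ℕ) : UnderLine (truncation n u) := by
  refine ⟨0, n, fun x hx => ?_⟩
  have h : primitive (truncation n u) x ≤ ENNReal.ofReal (n * x) := by
    refine (lintegral_mono fun t => truncation_le_nat n t).trans ?_
    rw [setLIntegral_const, Real.volume_Ioo, sub_zero, ENNReal.ofReal_mul (by positivity),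
      ENNReal.ofReal_natCast]
  refine ⟨ne_top_of_le_ne_top ENNReal.ofReal_ne_top h, ?_⟩
  have := ENNReal.toReal_mono ENNReal.ofReal_ne_top h
  rwa [ENNReal.toReal_ofReal (by positivity), ← zero_add (n * x : ℝ)] at this

end Truncation

/-! ### Comparison with averages and with the level function -/

theorem rpow_eq_mul_rpow_sub_one {r : ℝ} (hr : 1 ≤ r) (x : ℝ≥0∞) : x ^ r = x * x ^ (r - 1) := by
  nth_rewrite 2 [← ENNReal.rpow_one x]
  rw [← ENNReal.rpow_add_of_nonneg _ _ zero_le_one (by linarith)]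
  ring_nf

section Comparison

variable {f g u : ℝ → ℝ≥0∞} {c : ℝ≥0} {r : ℝ}

/-- The averaging operator is that of the level intervals of `g ^ (r - 1) u`. -/
theorem Majorizes.exists_average (hg : Majorizes f g c) (hr : 1 ≤ r) (hf : AntitoneOn f (Ioi 0))
    {C : ℝ≥0} (hC : ∀ t, 0 < t → f t ≤ C)
    (hu : AEMeasurable u (volume.restrict (Ioi 0))) {n : ℕ} (hn : 0 < n) :
    ∃ A ∈ averagingOperators, ∫⁻ t in Ioi (0 : ℝ), g t ^ r * truncation n u t ≤
      ∫⁻ t in Ioi (0 : ℝ), A f t ^ r * truncation n u t := by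
  have hr1 : 0 ≤ r - 1 := by linarith
  have hr0 : 0 ≤ r := by linarith
  have hgm := measurable_of_antitoneOn hg.anti
  have hfm := measurable_of_antitoneOn hf
  have htm := aemeasurable_truncation hu n
  set φ : ℝ → ℝ≥0∞ := fun t => g t ^ (r - 1) * truncation n u t with hφ
  have hφm : AEMeasurable φ (volume.restrict (Ioi 0)) := (hgm.pow_const _).mul htm
  have hφM : ∀ t, 0 < t → φ t ≤ ((c ^ (r - 1) * n : ℝ≥0) : ℝ≥0∞) := by
    intro t ht
    rw [ENNReal.coe_mul, ENNReal.coe_rpow_of_nonneg _ hr1, ENNReal.coe_natCast]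
    exact mul_le_mul' (ENNReal.rpow_le_rpow (hg.le_const t ht) hr1) (truncation_le_nat n t)
  obtain ⟨hline, S, A, hA, hAφ⟩ := exists_isAveraging_eq_levelFunction₀ hφm hφM
    (n := n) (by exact_mod_cast hn) fun t ht => by simp [hφ, truncation_eq_zero ht]
  have hψ := hline.antitoneOn_levelFunction₀
  have hψm := measurable_of_antitoneOn hψ
  have hgfin : ∀ t, 0 < t → g t ≠ ∞ := fun t ht =>
    ne_top_of_le_ne_top ENNReal.coe_ne_top (hg.le_const t ht)
  refine ⟨A, ⟨S, hA⟩, lintegral_rpow_le_of_le_mul hr ?_ ?_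
    (measurable_of_antitoneOn (hA.antitoneOn hf)) htm ?_ ?_⟩
  · filter_upwards [ae_restrict_mem measurableSet_Ioi] with t ht
    exact ne_top_of_le_ne_top ENNReal.coe_ne_top (hA.le_of_le hC ht)
  · filter_upwards [ae_restrict_mem measurableSet_Ioi] with t ht using hgfin t ht
  · refine ne_top_of_le_ne_top (b := ∫⁻ t in Ioi (0 : ℝ),
      (Iio (n : ℝ)).indicator (fun _ => (c : ℝ≥0∞) ^ r * n) t) ?_
      (setLIntegral_mono' measurableSet_Ioi fun t ht => ?_)
    · rw [lintegral_indicator measurableSet_Iio, setLIntegral_const,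
        Measure.restrict_apply measurableSet_Iio, Iio_inter_Ioi, Real.volume_Ioo]
      finiteness
    · rcases lt_or_ge t n with h | h
      · rw [indicator_of_mem (mem_Iio.2 h)]
        exact mul_le_mul' (ENNReal.rpow_le_rpow (hg.le_const t ht) hr0) (truncation_le_nat n t)
      · rw [truncation_eq_zero h, mul_zero]; exact zero_le
  · calc ∫⁻ t in Ioi (0 : ℝ), g t ^ r * truncation n u t = ∫⁻ t in Ioi (0 : ℝ), g t * φ t :=
          lintegral_congr fun t => by rw [rpow_eq_mul_rpow_sub_one hr, mul_assoc]
      _ ≤ ∫⁻ t in Ioi (0 : ℝ), g t * levelFunction₀ φ t :=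
          hardy_lemma (z := 0) hg.anti hgfin (by simp) hφm hψm
            fun y hy _ => hline.lintegral_le_levelFunction₀ hy
      _ ≤ ∫⁻ t in Ioi (0 : ℝ), levelFunction₀ φ t * f t := by
          simp_rw [mul_comm (g _)]
          exact hardy_lemma (z := 0) hψ (fun _ _ => ENNReal.ofReal_ne_top) (by simp) hgm hfm
            fun y hy _ => hg.lintegral_le y hy
      _ = ∫⁻ t in Ioi (0 : ℝ), f t * A φ t := by
          refine lintegral_congr_ae ?_
          filter_upwards [hAφ] with t ht
          rw [ht, mul_comm]
      _ = ∫⁻ t in Ioi (0 : ℝ), A f t * φ t := (hA.lintegral_symm hfm hφm).symm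

theorem Majorizes.wnorm_le_iSup_average (hg : Majorizes f g c) (hr : 1 ≤ r)
    (hf : AntitoneOn f (Ioi 0)) {C : ℝ≥0} (hC : ∀ t, 0 < t → f t ≤ C)
    (hu : AEMeasurable u (volume.restrict (Ioi 0))) :
    wnorm r u g ≤ ⨆ A ∈ averagingOperators, wnorm r u (A f) := by
  have hr0 : 0 < r := by linarith
  rw [wnorm, one_div, ENNReal.rpow_inv_le_iff hr0, lintegral_mul_eq_iSup_truncation
    ((measurable_of_antitoneOn hg.anti).pow_const r) hu]
  refine iSup_le fun n => ?_
  obtain ⟨A, hA, hle⟩ := hg.exists_average hr hf hC hu (Nat.succ_pos n)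
  have h1 : ∫⁻ t in Ioi (0 : ℝ), g t ^ r * truncation n u t ≤
      ∫⁻ t in Ioi (0 : ℝ), A f t ^ r * u t :=
    ((lintegral_mono fun t => mul_le_mul_right (truncation_mono t n.le_succ) _).trans hle).trans
      (lintegral_mono fun t => mul_le_mul_right (truncation_le _ t) _)
  rw [← ENNReal.rpow_inv_le_iff hr0, ← one_div]
  exact (ENNReal.rpow_le_rpow h1 (by positivity)).trans
    (le_iSup₂_of_le (f := fun A (_ : A ∈ averagingOperators) => wnorm r u (A f)) A hA le_rfl)

/-- Hardy's lemma is applied to `g ^ r`, and, after cutting the level function off at `n` to have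
finite integrals, to its product with `g ^ (r - 1)`. -/
theorem Majorizes.lintegral_le_levelFunction₀ (hg : Majorizes f g c) (hr : 1 ≤ r)
    (hf : AntitoneOn f (Ioi 0)) (hffin : ∀ t, 0 < t → f t ≠ ∞)
    (hu : AEMeasurable u (volume.restrict (Ioi 0))) (hline : UnderLine u) :
    ∫⁻ t in Ioi (0 : ℝ), g t ^ r * u t ≤ ∫⁻ t in Ioi (0 : ℝ), f t ^ r * levelFunction₀ u t := by
  have hr1 : 0 ≤ r - 1 := by linarith
  have hr0 : 0 ≤ r := by linarith
  have hgm := measurable_of_antitoneOn hg.anti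
  have hfm := measurable_of_antitoneOn hf
  have hψ := hline.antitoneOn_levelFunction₀
  have hψm := measurable_of_antitoneOn hψ
  have hgfin : ∀ t, 0 < t → g t ≠ ∞ := fun t ht =>
    ne_top_of_le_ne_top ENNReal.coe_ne_top (hg.le_const t ht)
  have hpow : ∀ {s : ℝ}, 0 ≤ s → AntitoneOn (fun t => g t ^ s) (Ioi 0) := fun hs x hx y hy hxy =>
    ENNReal.rpow_le_rpow (hg.anti hx hy hxy) hs
  refine (hardy_lemma (z := 0) (hpow hr0) (fun t ht => by have := hgfin t ht; finiteness)
    (by simp) hu hψm fun y hy _ => hline.lintegral_le_levelFunction₀ hy).trans ?_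
  rw [lintegral_Ioi_eq_iSup]
  refine iSup_le fun n => ?_
  set w : ℝ → ℝ≥0∞ := (Iio (n : ℝ)).indicator (levelFunction₀ u)
  have hwanti : AntitoneOn w (Ioi 0) := by
    intro x hx y hy hxy
    by_cases hyn : y ∈ Iio (n : ℝ)
    · simp only [w]
      rw [indicator_of_mem hyn, indicator_of_mem (mem_Iio.2 (hxy.trans_lt hyn))]
      exact hψ hx hy hxy
    · simp only [w]
      rw [indicator_of_notMem hyn]; exact zero_le
  have hwm := measurable_of_antitoneOn hwanti
  have hwfin : ∀ t, w t ≠ ∞ := fun t =>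
    ne_top_of_le_ne_top ENNReal.ofReal_ne_top (indicator_le_self (Iio (n : ℝ)) (levelFunction₀ u) t)
  have hw : ∀ F : ℝ → ℝ≥0∞, ∫⁻ t in Ioi (0 : ℝ), F t * w t =
      ∫⁻ t in Ioo (0 : ℝ) n, F t * levelFunction₀ u t := by
    intro F
    have : (fun t => F t * w t) = (Iio (n : ℝ)).indicator fun t => F t * levelFunction₀ u t := by
      ext t; by_cases ht : t ∈ Iio (n : ℝ) <;> simp [w, ht]
    rw [this, lintegral_indicator measurableSet_Iio, Measure.restrict_restrict measurableSet_Iio,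
      Iio_inter_Ioi]
  rw [← hw]
  refine (lintegral_rpow_le_of_le_mul hr (a := f) ?_ ?_ hfm hwm ?_ ?_).trans
    (lintegral_mono fun t => mul_le_mul_right
      (indicator_le_self (Iio (n : ℝ)) (levelFunction₀ u) t) _)
  · filter_upwards [ae_restrict_mem measurableSet_Ioi] with t ht using hffin t ht
  · filter_upwards [ae_restrict_mem measurableSet_Ioi] with t ht using hgfin t ht
  · rw [hw]
    rcases (Nat.cast_nonneg (α := ℝ) n).eq_or_lt with h0 | h0
    · simp [← h0]
    refine ne_top_of_le_ne_top (b := ∫⁻ t in Ioo (0 : ℝ) n, (c : ℝ≥0∞) ^ r * levelFunction₀ u t) ?_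
      (setLIntegral_mono' measurableSet_Ioo fun t ht =>
        mul_le_mul_left (ENNReal.rpow_le_rpow (hg.le_const t ht.1) hr0) _)
    rw [lintegral_const_mul' _ _ (by finiteness), hline.lintegral_levelFunction₀ h0]
    finiteness
  · have hanti : AntitoneOn (fun t => g t ^ (r - 1) * w t) (Ioi 0) := fun x hx y hy hxy =>
      mul_le_mul' (hpow hr1 hx hy hxy) (hwanti hx hy hxy)
    have := hardy_lemma (z := 0) hanti (fun t ht => by
      have := hgfin t ht; have := hwfin t; finiteness) (by simp) hgm hfm
      fun y hy _ => hg.lintegral_le y hy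
    refine le_trans (le_of_eq ?_) (this.trans (le_of_eq ?_))
    · exact lintegral_congr fun t => by rw [rpow_eq_mul_rpow_sub_one hr]; ring
    · exact lintegral_congr fun t => mul_comm _ _

theorem Majorizes.lintegral_le_levelFunction (hg : Majorizes f g c) (hr : 1 ≤ r)
    (hf : AntitoneOn f (Ioi 0)) (hffin : ∀ t, 0 < t → f t ≠ ∞)
    (hu : AEMeasurable u (volume.restrict (Ioi 0))) :
    ∫⁻ t in Ioi (0 : ℝ), g t ^ r * u t ≤ ∫⁻ t in Ioi (0 : ℝ), f t ^ r * levelFunction u t := by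
  by_cases hline : UnderLine u
  · simp only [levelFunction, if_pos hline]
    exact hg.lintegral_le_levelFunction₀ hr hf hffin hu hline
  · simp only [levelFunction, if_neg hline]
    rw [lintegral_mul_eq_iSup_truncation ((measurable_of_antitoneOn hg.anti).pow_const r) hu]
    exact iSup_le fun n => (hg.lintegral_le_levelFunction₀ hr hf hffin
      (aemeasurable_truncation hu n) (underLine_truncation n)).trans
      (lintegral_mono fun t => mul_le_mul_right
        (le_iSup (fun n => levelFunction₀ (truncation n u) t) n) _)

end Comparison

section Theta

variable {h : ℝ → ℝ≥0} {u : ℝ → ℝ≥0∞} {r : ℝ}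

theorem thetaNorm_le_of_majorizes (hh : h ∈ coneP) {X : ℝ≥0∞}
    (H : ∀ g c, Majorizes (toENN h) g c → wnorm r u g ≤ X) :
    thetaNorm halfLine r u (toENN h) ≤ X := by
  obtain ⟨c, hc⟩ := exists_bound_of_mem_coneP hh
  exact iSup_le fun k => iSup₂_le fun _ hk => H _ c (majorizes_rearr hh hc hk)

theorem thetaNorm_eq_iSup_average (hh : h ∈ coneP) (hr : 1 ≤ r)
    (hu : AEMeasurable u (volume.restrict (Ioi 0))) :
    thetaNorm halfLine r u (toENN h) = ⨆ A ∈ averagingOperators, wnorm r u (A (toENN h)) := by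
  obtain ⟨C, hC⟩ := exists_bound_of_mem_coneP hh
  exact le_antisymm (thetaNorm_le_of_majorizes hh fun g c hg =>
      hg.wnorm_le_iSup_average hr (antitoneOn_toENN hh) hC hu)
    (iSup₂_le fun A hA => wnorm_average_le_thetaNorm hh (by linarith) u hA)

theorem thetaNorm_le_hardyMean (hh : h ∈ coneP) (hr : 0 < r) :
    thetaNorm halfLine r u (toENN h) ≤ wnorm r u (hardyMean (toENN h)) :=
  thetaNorm_le_of_majorizes hh fun g c hg => ENNReal.rpow_le_rpow
    (setLIntegral_mono' measurableSet_Ioi fun t ht =>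
      mul_le_mul_left (ENNReal.rpow_le_rpow (hg.le_hardyMean t ht) hr.le) _) (by positivity)

theorem thetaNorm_le_levelFunction (hh : h ∈ coneP) (hr : 1 ≤ r)
    (hu : AEMeasurable u (volume.restrict (Ioi 0))) :
    thetaNorm halfLine r u (toENN h) ≤ wnorm r (levelFunction u) (toENN h) :=
  thetaNorm_le_of_majorizes hh fun _ _ hg => ENNReal.rpow_le_rpow
    (hg.lintegral_le_levelFunction hr (antitoneOn_toENN hh) (fun t _ => toENN_ne_top h t) hu)
    (by positivity)

end Theta

/-! ### Decomposition of the cone -/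

/-- Inscribed polygons of a non-negative concave function, through the origin and constant beyond
the last node, are combinations of the functions `min · sⱼ` with non-negative coefficients (the
drops of slope at the nodes). -/
theorem exists_polygon {L : ℝ → ℝ} (hL : ConcaveOn ℝ (Ioi 0) L) (h0 : ∀ x, 0 < x → 0 ≤ L x)
    {s : ℕ → ℝ} (hs0 : 0 < s 0) (hs : StrictMono s) {θ : ℝ} (hθ : 1 < θ)
    (hsθ : ∀ j, s (j + 1) ≤ θ * s j) (N : ℕ) :
    ∃ c : ℕ → ℝ, (∀ j, 0 ≤ c j) ∧ (∀ y, s N < y → L y ≤ L (s N) + c N * (y - s N)) ∧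
      (∀ x, 0 < x → ∑ j ∈ Finset.range (N + 1), c j * min x (s j) ≤ L x) ∧
      (∀ x, s N ≤ x → ∑ j ∈ Finset.range (N + 1), c j * min x (s j) = L (s N)) ∧
      (∀ x, s 0 ≤ x → x ≤ s N → L x ≤ θ * ∑ j ∈ Finset.range (N + 1), c j * min x (s j)) ∧
      (∀ x, x ≤ s 0 → ∑ j ∈ Finset.range (N + 1), c j * min x (s j) = x * (L (s 0) / s 0)) := by
  have hpos : ∀ j, 0 < s j := fun j => hs0.trans_le (hs.monotone (Nat.zero_le j))
  induction N with
  | zero =>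
    have hd : L (s 0) / s 0 * s 0 = L (s 0) := div_mul_cancel₀ _ hs0.ne'
    have hc0 : 0 ≤ L (s 0) / s 0 := div_nonneg (h0 _ hs0) hs0.le
    refine ⟨fun _ => L (s 0) / s 0, fun _ => hc0, fun y hy => ?_, fun x hx => ?_, fun x hx => ?_,
      fun x h1 h2 => ?_, fun x hx => ?_⟩ <;> simp only [zero_add, Finset.sum_range_one]
    · have := hL.mul_le_mul_of_nonneg h0 hs0 hy.le
      rw [mul_sub, hd, div_mul_eq_mul_div, add_sub_cancel, le_div_iff₀ hs0]
      linarith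
    · rcases le_total x (s 0) with h | h
      · rw [min_eq_left h, div_mul_eq_mul_div, div_le_iff₀ hs0]
        linarith [hL.mul_le_mul_of_nonneg h0 hx h]
      · rw [min_eq_right h, hd]
        exact hL.monotoneOn_of_nonneg h0 hs0 hx h
    · rw [min_eq_right hx, hd]
    · rw [le_antisymm h2 h1, min_self, hd]
      nlinarith [h0 _ hs0]
    · rw [min_eq_left hx, mul_comm]
  | succ N ih =>
    obtain ⟨c, hc, hA, hB, hC, hD, hE⟩ := ih
    have hlt : s N < s (N + 1) := hs (Nat.lt_succ_self N)
    set m := (L (s (N + 1)) - L (s N)) / (s (N + 1) - s N) with hm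
    have hmd : m * (s (N + 1) - s N) = L (s (N + 1)) - L (s N) :=
      div_mul_cancel₀ _ (by linarith)
    have hm0 : 0 ≤ m := div_nonneg (sub_nonneg.2 (hL.monotoneOn_of_nonneg h0 (hpos N)
      (hpos (N + 1)) hlt.le)) (by linarith)
    have hmc : m ≤ c N := by
      rw [hm, div_le_iff₀ (by linarith)]
      linarith [hA _ hlt]
    have hmono : s 0 ≤ s N := hs.monotone (Nat.zero_le N)
    set c' : ℕ → ℝ := fun j => if j < N then c j else if j = N then c N - m else m with hc'
    have hR : ∀ x, ∑ j ∈ Finset.range (N + 1 + 1), c' j * min x (s j) =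
        ∑ j ∈ Finset.range (N + 1), c j * min x (s j) + m * (min x (s (N + 1)) - min x (s N)) := by
      intro x
      rw [Finset.sum_range_succ, Finset.sum_range_succ, Finset.sum_range_succ,
        Finset.sum_congr rfl fun j hj => by
          rw [show c' j = c j from if_pos (Finset.mem_range.1 hj)]]
      simp only [hc', lt_irrefl, if_false, if_true, show ¬ N + 1 < N by omega,
        show ¬ N + 1 = N by omega]
      ring
    have hlow : ∀ x, x ≤ s N → ∑ j ∈ Finset.range (N + 1 + 1), c' j * min x (s j) =
        ∑ j ∈ Finset.range (N + 1), c j * min x (s j) := by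
      intro x hx
      rw [hR, min_eq_left hx, min_eq_left (hx.trans hlt.le)]
      ring
    have hmid : ∀ x, s N ≤ x → x ≤ s (N + 1) →
        ∑ j ∈ Finset.range (N + 1 + 1), c' j * min x (s j) = L (s N) + m * (x - s N) := by
      intro x h1 h2
      rw [hR, min_eq_left h2, min_eq_right h1, hC x h1]
    have hhigh : ∀ x, s (N + 1) ≤ x →
        ∑ j ∈ Finset.range (N + 1 + 1), c' j * min x (s j) = L (s (N + 1)) := by
      intro x hx
      rw [hR, min_eq_right hx, min_eq_right (hlt.le.trans hx), hC x (hlt.le.trans hx), hmd]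
      ring
    refine ⟨c', fun j => ?_, fun y hy => ?_, fun x hx => ?_, hhigh, fun x h1 h2 => ?_,
      fun x hx => ?_⟩
    · simp only [hc']
      split_ifs
      · exact hc j
      · linarith
      · exact hm0
    · have h := hL.le_chord_right (hpos N) ((hpos (N + 1)).trans hy) hlt hy
      simp only [hc', show ¬ N + 1 < N by omega, show ¬ N + 1 = N by omega, if_false]
      rw [← hm] at h
      linarith
    · rcases le_total x (s N) with h1 | h1
      · rw [hlow x h1]; exact hB x hx
      rcases le_total x (s (N + 1)) with h2 | h2
      · rw [hmid x h1 h2]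
        exact hL.chord_le (hpos N) (hpos (N + 1)) h1 h2 hlt
      · rw [hhigh x h2]
        exact hL.monotoneOn_of_nonneg h0 (hpos (N + 1)) hx h2
    · rcases le_total x (s N) with h3 | h3
      · rw [hlow x h3]; exact hD x h1 h3
      · rw [hmid x h3 h2]
        have hsN := hpos N
        have h4 := hL.mul_le_mul_of_nonneg h0 hsN h3
        have h5 : x ≤ θ * s N := h2.trans (hsθ N)
        have h6 : 0 ≤ m * (x - s N) := mul_nonneg hm0 (by linarith)
        have h7 : s N * L x ≤ s N * (θ * L (s N)) := by nlinarith [h0 _ hsN]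
        have h8 := le_of_mul_le_mul_left h7 hsN
        nlinarith
    · rw [hlow x (hx.trans hmono)]; exact hE x hx

/-- The least concave majorant of a quasi-concave function is at most twice that function. -/
theorem leastConcaveMajorant_le_two_mul {Q : ℝ → ℝ} (hQ0 : ∀ x, 0 < x → 0 ≤ Q x)
    (hQ : MonotoneOn Q (Ioi 0)) (hQ' : ∀ x y, 0 < x → x ≤ y → x * Q y ≤ y * Q x) :
    (∃ G : ℝ → ℝ, ConcaveOn ℝ (Ioi 0) G ∧ ∀ y ∈ Ioi (0 : ℝ), Q y ≤ G y) ∧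
      ∀ x, 0 < x → leastConcaveMajorant Q x ≤ 2 * Q x := by
  have key : ∀ x, 0 < x → ∀ y ∈ Ioi (0 : ℝ), Q y ≤ Q x + Q x / x * y := by
    intro x hx y hy
    have hy' : 0 < y := hy
    have h1 : 0 ≤ Q x / x * y := mul_nonneg (div_nonneg (hQ0 x hx) hx.le) hy'.le
    rcases le_total y x with h | h
    · linarith [hQ hy hx h]
    · have : Q y ≤ Q x / x * y := by
        rw [div_mul_eq_mul_div, le_div_iff₀ hx]
        linarith [hQ' x y hx h]
      linarith [hQ0 x hx]
  refine ⟨⟨_, concaveOn_line _ _ _ (convex_Ioi 0), key 1 one_pos⟩, fun x hx => ?_⟩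
  refine (leastConcaveMajorant_le (concaveOn_line _ _ _ (convex_Ioi 0)) (key x hx) hx).trans ?_
  rw [div_mul_cancel₀ _ hx.ne']
  linarith

theorem omegaFn_rpow {z t r : ℝ} (hz : 0 < z) (ht : 0 < t) (hr : 0 < r) :
    omegaFn z t ^ r = ENNReal.ofReal (min (t ^ (2 * r))⁻¹ (z ^ (2 * r))⁻¹) := by
  have e : ∀ x : ℝ, 0 < x → ((x ^ 2)⁻¹) ^ r = (x ^ (2 * r))⁻¹ := fun x hx => by
    rw [Real.inv_rpow (by positivity), ← Real.rpow_natCast, ← Real.rpow_mul hx.le]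
    norm_num
  rw [omegaFn, ENNReal.ofReal_rpow_of_nonneg (by positivity) hr.le,
    (Real.monotoneOn_rpow_Ici_of_exponent_nonneg hr.le).map_min
      (mem_Ici.2 (by positivity)) (mem_Ici.2 (by positivity)), e t ht, e z hz]

/-- Up to a factor of two, the `r`-th power of a function in the cone is a positive combination of
`r`-th powers of the functions `ω_z`, `z > 1`. -/
theorem exists_omega_sum {h : ℝ → ℝ≥0} (hh : h ∈ coneP) {r : ℝ} (hr : 0 < r) {ϑ : ℝ} (hϑ : 1 < ϑ)
    (T : ℝ) : ∃ (N : ℕ) (c : ℕ → ℝ≥0∞) (z : ℕ → ℝ), (∀ j, 1 < z j) ∧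
      (∀ t, 0 < t → t ≤ T → toENN h t ^ r ≤
        ENNReal.ofReal ϑ * ∑ j ∈ Finset.range N, c j * omegaFn (z j) t ^ r) ∧
      ∀ t, 0 < t → ∑ j ∈ Finset.range N, c j * omegaFn (z j) t ^ r ≤ 2 * toENN h t ^ r := by
  obtain ⟨hmono, hanti, C, hC⟩ := hh
  set κ := 2 * r with hκ
  have hκ0 : 0 < κ := by positivity
  set F : ℝ → ℝ := fun t => (h t : ℝ) ^ r with hF
  have hF0 : ∀ t, 0 ≤ F t := fun t => by positivity
  have hFanti : ∀ x y, 0 < x → x ≤ y → F y ≤ F x := fun x y hx hxy =>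
    Real.rpow_le_rpow (NNReal.coe_nonneg _) (hanti hx (hx.trans_le hxy) hxy) hr.le
  have hFmono : ∀ x y, 0 < x → x ≤ y → x ^ κ * F x ≤ y ^ κ * F y := by
    intro x y hx hxy
    have hy := hx.trans_le hxy
    have := Real.rpow_le_rpow (by positivity) (hmono hx hy hxy) hr.le
    have e : ∀ t : ℝ, 0 < t → (t ^ 2 * (h t : ℝ)) ^ r = t ^ κ * F t := fun t ht => by
      rw [Real.mul_rpow (by positivity) (NNReal.coe_nonneg _), ← Real.rpow_natCast,
        ← Real.rpow_mul ht.le]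
      norm_num [hκ, hF]
    simpa only [e x hx, e y hy] using this
  have hinv : ∀ x : ℝ, 0 < x → (x ^ κ⁻¹) ^ κ = x := fun x hx =>
    Real.rpow_inv_rpow hx.le hκ0.ne'
  have hinv' : ∀ x : ℝ, 0 < x → (x ^ κ) ^ κ⁻¹ = x := fun x hx =>
    Real.rpow_rpow_inv hx.le hκ0.ne'
  set Q : ℝ → ℝ := fun s => s * F (s ^ κ⁻¹) with hQ
  have hQ0 : ∀ x, 0 < x → 0 ≤ Q x := fun x hx => mul_nonneg hx.le (hF0 _)
  have hQmono : MonotoneOn Q (Ioi 0) := by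
    intro x hx y hy hxy
    have := hFmono (x ^ κ⁻¹) (y ^ κ⁻¹) (Real.rpow_pos_of_pos hx _)
      (Real.rpow_le_rpow (le_of_lt hx) hxy (by positivity))
    rwa [hinv x hx, hinv y hy] at this
  obtain ⟨hex, hL2⟩ := leastConcaveMajorant_le_two_mul hQ0 hQmono (by
    intro x y hx hxy
    have := hFanti (x ^ κ⁻¹) (y ^ κ⁻¹) (Real.rpow_pos_of_pos hx _)
      (Real.rpow_le_rpow hx.le hxy (by positivity))
    simp only [hQ]
    have hy := hx.trans_le hxy
    nlinarith [mul_pos hx hy])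
  set L := leastConcaveMajorant Q
  have hLconc : ConcaveOn ℝ (Ioi 0) L := concaveOn_leastConcaveMajorant hex
  have hQL : ∀ x, 0 < x → Q x ≤ L x := fun x hx => le_leastConcaveMajorant hex hx
  have hL0 : ∀ x, 0 < x → 0 ≤ L x := fun x hx => (hQ0 x hx).trans (hQL x hx)
  set θ := √ϑ with hθdef
  have hθ : 1 < θ := by rw [hθdef, Real.lt_sqrt zero_le_one]; simpa using hϑ
  have hθ0 : 0 < θ := by linarith
  have hθ2 : θ * θ = ϑ := Real.mul_self_sqrt (by linarith)
  set s : ℕ → ℝ := fun j => θ ^ (j + 1) with hs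
  have hspos : ∀ j, 0 < s j := fun j => by positivity
  obtain ⟨N, hN⟩ := pow_unbounded_of_one_lt (T ^ κ) hθ
  have hTN : T ^ κ ≤ s N := hN.le.trans (pow_le_pow_right₀ hθ.le (Nat.le_succ N))
  obtain ⟨c, hc0, -, hB, -, hD, hE⟩ := exists_polygon hLconc hL0 (s := s) (hspos 0)
    (fun i j hij => pow_lt_pow_right₀ hθ (by omega)) hθ
    (fun j => by simp only [hs]; rw [pow_succ θ (j + 1), mul_comm]) N
  -- the polygon in the variable `s = t ^ κ`, divided by `s`
  have hterm : ∀ t, 0 < t → ∀ j,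
      ENNReal.ofReal (c j * s j) * omegaFn ((s j) ^ κ⁻¹) t ^ r =
        ENNReal.ofReal (c j * min (t ^ κ) (s j) / t ^ κ) := by
    intro t ht j
    have htk : 0 < t ^ κ := Real.rpow_pos_of_pos ht _
    have hsj := hspos j
    rw [omegaFn_rpow (Real.rpow_pos_of_pos (hspos j) _) ht hr, ← hκ, hinv _ (hspos j),
      ← ENNReal.ofReal_mul (mul_nonneg (hc0 j) (hspos j).le)]
    congr 1
    rcases le_total (t ^ κ) (s j) with h1 | h1
    · rw [min_eq_left h1, min_eq_right ((inv_le_inv₀ hsj htk).2 h1)]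
      field_simp
    · rw [min_eq_right h1, min_eq_left ((inv_le_inv₀ htk hsj).2 h1)]
      field_simp
  have hsum : ∀ t, 0 < t → ∑ j ∈ Finset.range (N + 1),
      ENNReal.ofReal (c j * s j) * omegaFn ((s j) ^ κ⁻¹) t ^ r =
        ENNReal.ofReal ((∑ j ∈ Finset.range (N + 1), c j * min (t ^ κ) (s j)) / t ^ κ) := by
    intro t ht
    have htk : 0 < t ^ κ := Real.rpow_pos_of_pos ht _
    rw [Finset.sum_congr rfl fun j _ => hterm t ht j, Finset.sum_div, ENNReal.ofReal_sum_of_nonneg]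
    intro j _
    have := hspos j
    have := hc0 j
    positivity
  have hFE : ∀ t, toENN h t ^ r = ENNReal.ofReal (F t) := fun t => by
    rw [toENN, hF, ← ENNReal.ofReal_rpow_of_nonneg (NNReal.coe_nonneg _) hr.le,
      ENNReal.ofReal_coe_nnreal]
  refine ⟨N + 1, fun j => ENNReal.ofReal (c j * s j), fun j => (s j) ^ κ⁻¹, fun j => ?_, ?_, ?_⟩
  · exact Real.one_lt_rpow (one_lt_pow₀ hθ (Nat.succ_ne_zero j)) (by positivity)
  · intro t ht htT
    have htk : 0 < t ^ κ := Real.rpow_pos_of_pos ht _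
    have hQt : Q (t ^ κ) = t ^ κ * F t := by simp only [hQ, hinv' t ht]
    rw [hsum t ht, hFE, ← ENNReal.ofReal_mul (by linarith)]
    refine ENNReal.ofReal_le_ofReal ?_
    rcases le_total (s 0) (t ^ κ) with h1 | h1
    · have h2 := hD _ h1 ((Real.rpow_le_rpow ht.le htT hκ0.le).trans hTN)
      have h3 := hQL _ htk
      have h4 := hB _ htk
      set R := ∑ j ∈ Finset.range (N + 1), c j * min (t ^ κ) (s j)
      have hR0 : 0 ≤ R := by
        by_contra! hneg
        nlinarith [hL0 _ htk]
      rw [← mul_div_assoc, le_div_iff₀ htk, mul_comm, ← hQt]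
      nlinarith
    · rw [hE _ h1, mul_div_cancel_left₀ _ htk.ne']
      have hs0 : s 0 = θ := by simp [hs]
      rw [hs0] at h1 ⊢
      have h2 : Q θ / θ ≤ L θ / θ := div_le_div_of_nonneg_right (hQL θ hθ0) hθ0.le
      -- on `(0, 1)` the function is constant, so that it may be evaluated at `θ ^ (-1/κ)`
      have h3 : F t ≤ θ * Q θ := by
        rcases lt_or_ge t 1 with ht1 | ht1
        · have h5 : (θ⁻¹) ^ κ⁻¹ < 1 := Real.rpow_lt_one (by positivity) (inv_lt_one_of_one_lt₀ hθ)
            (by positivity)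
          have h6 : F ((θ⁻¹) ^ κ⁻¹) = F t := by
            simp only [hF, hC t ⟨ht, ht1⟩, hC _ ⟨Real.rpow_pos_of_pos (by positivity) _, h5⟩]
          have h7 := hQmono (mem_Ioi.2 (inv_pos.2 hθ0)) (mem_Ioi.2 hθ0)
            ((inv_lt_one_of_one_lt₀ hθ).trans hθ).le
          simp only [hQ] at h7 ⊢
          rw [h6, inv_mul_le_iff₀ hθ0] at h7
          exact h7
        · have h5 := hQmono (mem_Ioi.2 htk) (mem_Ioi.2 hθ0) h1
          rw [hQt] at h5
          have h6 : 1 ≤ t ^ κ := Real.one_le_rpow ht1 hκ0.le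
          nlinarith [hF0 t, hQ0 θ hθ0]
      calc F t ≤ θ * Q θ := h3
        _ = ϑ * (Q θ / θ) := by rw [← hθ2]; field_simp
        _ ≤ ϑ * (L θ / θ) := mul_le_mul_of_nonneg_left h2 (by linarith)
  · intro t ht
    have htk : 0 < t ^ κ := Real.rpow_pos_of_pos ht _
    have hQt : Q (t ^ κ) = t ^ κ * F t := by simp only [hQ, hinv' t ht]
    rw [hsum t ht, hFE, show (2 : ℝ≥0∞) = ENNReal.ofReal 2 by simp,
      ← ENNReal.ofReal_mul (by norm_num)]
    refine ENNReal.ofReal_le_ofReal ?_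
    rw [div_le_iff₀ htk]
    have := (hB _ htk).trans (hL2 _ htk)
    rw [hQt] at this
    linarith

/-! ### Reduction to the functions `ω_z` by averages -/

section WeightedNorm

variable {p : ℝ} {w : ℝ → ℝ≥0∞}

theorem wnorm_mono (hp : 0 < p) {f g : ℝ → ℝ≥0∞} (h : ∀ t, 0 < t → f t ≤ g t) :
    wnorm p w f ≤ wnorm p w g :=
  ENNReal.rpow_le_rpow (setLIntegral_mono' measurableSet_Ioi fun t ht =>
    mul_le_mul_left (ENNReal.rpow_le_rpow (h t ht) hp.le) _) (by positivity)

theorem wnorm_rpow_self (hp : 0 < p) (f : ℝ → ℝ≥0∞) :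
    wnorm p w f ^ p = ∫⁻ t in Ioi (0 : ℝ), f t ^ p * w t := by
  rw [wnorm, ← ENNReal.rpow_mul, one_div_mul_cancel hp.ne', ENNReal.rpow_one]

theorem wnorm_const_mul (hp : 0 < p) (hw : AEMeasurable w (volume.restrict (Ioi 0)))
    {f : ℝ → ℝ≥0∞} (hf : AEMeasurable f (volume.restrict (Ioi 0))) (c : ℝ≥0∞) :
    wnorm p w (fun t => c * f t) = c * wnorm p w f := by
  simp only [wnorm, ENNReal.mul_rpow_of_nonneg _ _ hp.le, mul_assoc]
  rw [lintegral_const_mul'' (f := fun t => f t ^ p * w t) _ ((hf.pow_const p).mul hw),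
    ENNReal.mul_rpow_of_nonneg _ _ (by positivity), ← ENNReal.rpow_mul,
    mul_one_div_cancel hp.ne', ENNReal.rpow_one]

theorem wnorm_eq_withDensity (hw : AEMeasurable w (volume.restrict (Ioi 0)))
    {f : ℝ → ℝ≥0∞} (hf : AEMeasurable f (volume.restrict (Ioi 0))) :
    wnorm p w f = (∫⁻ t, f t ^ p ∂(volume.restrict (Ioi 0)).withDensity w) ^ (1 / p) := by
  rw [lintegral_withDensity_eq_lintegral_mul₀ hw (hf.pow_const p), wnorm]
  simp only [Pi.mul_apply, mul_comm]

variable {ι : Type*}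

theorem wnorm_sum_le (hp : 1 ≤ p) (hw : AEMeasurable w (volume.restrict (Ioi 0))) (s : Finset ι)
    {f : ι → ℝ → ℝ≥0∞} (hf : ∀ i, AEMeasurable (f i) (volume.restrict (Ioi 0))) :
    wnorm p w (fun t => ∑ i ∈ s, f i t) ≤ ∑ i ∈ s, wnorm p w (f i) := by
  classical
  have hp0 : 0 < p := by linarith
  have hs : ∀ s : Finset ι, AEMeasurable (fun t => ∑ i ∈ s, f i t) (volume.restrict (Ioi 0)) :=
    fun s => Finset.aemeasurable_fun_sum s fun i _ => hf i
  have hac := withDensity_absolutelyContinuous (volume.restrict (Ioi (0 : ℝ))) w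
  induction s using Finset.induction_on with
  | empty => simp [wnorm, ENNReal.zero_rpow_of_pos hp0, hp0]
  | insert i s hi ih =>
    rw [Finset.sum_insert hi]
    refine le_trans ?_ (add_le_add le_rfl ih)
    rw [wnorm_eq_withDensity hw (hs _), wnorm_eq_withDensity hw (hs _),
      wnorm_eq_withDensity hw (hf i)]
    simp only [Finset.sum_insert hi]
    exact ENNReal.lintegral_Lp_add_le ((hf i).mono_ac hac) ((hs s).mono_ac hac) hp

theorem sum_wnorm_le (hp : 0 < p) (hp1 : p ≤ 1) (hw : AEMeasurable w (volume.restrict (Ioi 0)))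
    (s : Finset ι) {f : ι → ℝ → ℝ≥0∞} (hf : ∀ i, AEMeasurable (f i) (volume.restrict (Ioi 0))) :
    ∑ i ∈ s, wnorm p w (f i) ≤ wnorm p w (fun t => ∑ i ∈ s, f i t) := by
  have hac := withDensity_absolutelyContinuous (volume.restrict (Ioi (0 : ℝ))) w
  rw [wnorm_eq_withDensity hw (Finset.aemeasurable_fun_sum s fun i _ => hf i),
    Finset.sum_congr rfl fun i _ => wnorm_eq_withDensity hw (hf i)]
  exact reverse_minkowski_sum hp hp1 s fun i _ => (hf i).mono_ac hac

end WeightedNorm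

theorem le_of_forall_one_lt_mul {X Y : ℝ≥0∞} (h : ∀ ϑ : ℝ, 1 < ϑ → X ≤ ENNReal.ofReal ϑ * Y) :
    X ≤ Y := by
  by_cases hY : Y = ∞
  · simp [hY]
  have h1 : Filter.Tendsto (fun ϑ : ℝ => ENNReal.ofReal ϑ * Y) (nhdsWithin 1 (Ioi 1))
      (nhds (ENNReal.ofReal 1 * Y)) :=
    (((ENNReal.continuous_mul_const hY).comp ENNReal.continuous_ofReal).tendsto 1).mono_left
      nhdsWithin_le_nhds
  rw [ENNReal.ofReal_one, one_mul] at h1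
  exact ge_of_tendsto h1 (by filter_upwards [self_mem_nhdsWithin] with ϑ hϑ using h ϑ hϑ)

namespace IsAveraging

variable {S : Set (ℝ × ℝ)} {A : (ℝ → ℝ≥0∞) → ℝ → ℝ≥0∞}

/-- The values of `A f` on `(0, n)` depend on those of `f` on some bounded interval only. -/
theorem exists_local_mono (hA : IsAveraging S A) (n : ℝ) : ∃ T, ∀ f g : ℝ → ℝ≥0∞,
    (∀ t, 0 < t → t ≤ T → f t ≤ g t) → ∀ x ∈ Ioo 0 n, A f x ≤ A g x := by
  obtain ⟨T, hnT, hT⟩ : ∃ T, n ≤ T ∧ ∀ J ∈ S, ∀ x ∈ Ioo J.1 J.2, x < n → J.2 ≤ T := by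
    by_cases hI : ∃ I ∈ S, n ∈ Ioo I.1 I.2
    · obtain ⟨I, hI, hn⟩ := hI
      refine ⟨I.2, hn.2.le, fun J hJ x hx hxn => not_lt.1 fun hlt => ?_⟩
      have he := hA.2.1.elim_set hI hJ n hn ⟨hx.1.trans hxn, hn.2.trans hlt⟩
      rw [he] at hlt
      exact lt_irrefl _ hlt
    · exact ⟨n, le_rfl, fun J hJ x hx hxn => not_lt.1 fun hlt =>
        hI ⟨J, hJ, hx.1.trans hxn, hlt⟩⟩
  refine ⟨T, fun f g h x hx => ?_⟩
  by_cases hI : ∃ I ∈ S, x ∈ Ioo I.1 I.2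
  · obtain ⟨I, hI, hxI⟩ := hI
    rw [hA.apply_eq f hI hxI, hA.apply_eq g hI hxI]
    exact mul_le_mul_right (setLIntegral_mono' measurableSet_Ioo fun t ht =>
      h t (hA.Ioo_subset hI ht) (ht.2.le.trans (hT I hI x hxI hx.2))) _
  · rw [hA.apply_of_notMem f hI, hA.apply_of_notMem g hI]
    exact h x hx.1 (hx.2.le.trans hnT)

theorem apply_sum (hA : IsAveraging S A) {ι : Type*} (s : Finset ι) (c : ι → ℝ≥0∞)
    {f : ι → ℝ → ℝ≥0∞} (hf : ∀ i, AEMeasurable (f i) (volume.restrict (Ioi 0))) (x : ℝ) :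
    A (fun t => ∑ i ∈ s, c i * f i t) x = ∑ i ∈ s, c i * A (f i) x := by
  by_cases hI : ∃ I ∈ S, x ∈ Ioo I.1 I.2
  · obtain ⟨I, hI, hxI⟩ := hI
    have hfi := fun i => (hf i).mono_set (hA.Ioo_subset hI)
    rw [hA.apply_eq _ hI hxI, lintegral_finsetSum' s fun i _ => (hfi i).const_mul (c i),
      Finset.mul_sum]
    refine Finset.sum_congr rfl fun i _ => ?_
    rw [hA.apply_eq _ hI hxI, lintegral_const_mul'' _ (hfi i)]
    ring
  · rw [hA.apply_of_notMem _ hI]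
    exact Finset.sum_congr rfl fun i _ => by rw [hA.apply_of_notMem _ hI]

end IsAveraging

section Omega

theorem exists_coneP_eq_omegaFn {z : ℝ} (hz : 1 ≤ z) : ∃ h ∈ coneP, toENN h = omegaFn z := by
  have hz0 : 0 < z := by linarith
  have hnn : ∀ t : ℝ, 0 ≤ min (t ^ 2)⁻¹ (z ^ 2)⁻¹ := fun t => by positivity
  refine ⟨fun t => (min (t ^ 2)⁻¹ (z ^ 2)⁻¹).toNNReal, ⟨?_, ?_, ((z ^ 2)⁻¹).toNNReal, ?_⟩, rfl⟩
  · intro x hx y hy hxy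
    have hx' : 0 < x := hx
    have hy' : 0 < y := hy
    simp only [Real.coe_toNNReal _ (hnn _)]
    rw [mul_min_of_nonneg _ _ (by positivity), mul_min_of_nonneg _ _ (by positivity),
      mul_inv_cancel₀ (by positivity), mul_inv_cancel₀ (by positivity)]
    gcongr
  · intro x hx y hy hxy
    have hx' : 0 < x := hx
    have hy' : 0 < y := hy
    refine Real.toNNReal_le_toNNReal ?_
    gcongr
  · rintro t ⟨h0, h1⟩
    have : (z ^ 2)⁻¹ ≤ (t ^ 2)⁻¹ := by gcongr; linarith
    simp only [min_eq_right this]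

theorem antitoneOn_omegaFn {z : ℝ} (hz : 1 ≤ z) : AntitoneOn (omegaFn z) (Ioi 0) := by
  obtain ⟨h, hh, e⟩ := exists_coneP_eq_omegaFn hz
  exact e ▸ antitoneOn_toENN hh

end Omega

theorem CTheta_le_two_mul_COmega {p q : ℝ} (hp : 0 < p) (hp2 : p ≤ 2) (hq2 : 2 ≤ q)
    {u v : ℝ → ℝ≥0∞} (hu : AEMeasurable u (volume.restrict (Ioi 0)))
    (hv : AEMeasurable v (volume.restrict (Ioi 0))) :
    CTheta p q u v ≤ 2 * COmega p q u v := by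
  by_cases hC : COmega p q u v = ∞
  · simp [hC]
  set C := COmega p q u v with hCdef
  have hp' : 0 < p / 2 := by positivity
  have hq' : 1 ≤ q / 2 := by linarith
  have hq0 : 0 < q / 2 := by linarith
  refine iSup₂_le fun h hh => ?_
  by_cases hV : wnorm (p / 2) v (toENN h) = ∞
  · simp [hV]
  refine ENNReal.div_le_of_le_mul ?_
  rw [thetaNorm_eq_iSup_average hh hq' hu]
  refine iSup₂_le fun A hAA => ?_
  obtain ⟨S, hA⟩ : ∃ S, IsAveraging S A := hAA
  refine le_of_forall_one_lt_mul fun ϑ hϑ => ?_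
  rw [wnorm, one_div, ENNReal.rpow_inv_le_iff hq0, lintegral_Ioi_eq_iSup]
  refine iSup_le fun n => ?_
  obtain ⟨T, hT⟩ := hA.exists_local_mono n
  obtain ⟨N, c, z, hz, hlow, hup⟩ := exists_omega_sum hh one_pos hϑ T
  simp only [ENNReal.rpow_one] at hlow hup
  have hωm : ∀ j, AEMeasurable (omegaFn (z j)) (volume.restrict (Ioi 0)) := fun j =>
    measurable_of_antitoneOn (antitoneOn_omegaFn (hz j).le)
  have hAωm : ∀ j, AEMeasurable (A (omegaFn (z j))) (volume.restrict (Ioi 0)) := fun j =>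
    measurable_of_antitoneOn (hA.antitoneOn (antitoneOn_omegaFn (hz j).le))
  have hV2 : wnorm (p / 2) v (fun t => ∑ j ∈ Finset.range N, c j * omegaFn (z j) t) ≤
      2 * wnorm (p / 2) v (toENN h) := by
    rw [← wnorm_const_mul hp' hv (measurable_of_antitoneOn (antitoneOn_toENN hh))]
    exact wnorm_mono hp' hup
  have hsum : ∑ j ∈ Finset.range N, c j * wnorm (p / 2) v (omegaFn (z j)) ≤
      2 * wnorm (p / 2) v (toENN h) := by
    refine le_trans (le_of_eq ?_) ((sum_wnorm_le hp' (by linarith) hv (Finset.range N)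
      fun j => (hωm j).const_mul (c j)).trans hV2)
    exact Finset.sum_congr rfl fun j _ => (wnorm_const_mul hp' hv (hωm j) (c j)).symm
  have hterm : ∀ j ∈ Finset.range N, c j * wnorm (q / 2) u (A (omegaFn (z j))) ≤
      C * (c j * wnorm (p / 2) v (omegaFn (z j))) := by
    intro j hj
    by_cases hc : c j = 0
    · simp [hc]
    have hfin : wnorm (p / 2) v (omegaFn (z j)) ≠ ∞ := by
      intro htop
      have h1 := (Finset.single_le_sum (f := fun j => c j * wnorm (p / 2) v (omegaFn (z j)))
        (fun _ _ => zero_le) hj).trans hsum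
      simp only [htop, ENNReal.mul_top hc, top_le_iff] at h1
      exact ENNReal.mul_ne_top (by simp) hV h1
    obtain ⟨k, hk, e⟩ := exists_coneP_eq_omegaFn (hz j).le
    have h1 : wnorm (q / 2) u (A (omegaFn (z j))) ≤ thetaNorm halfLine (q / 2) u (omegaFn (z j)) :=
      e ▸ wnorm_average_le_thetaNorm hk hq0 u ⟨S, hA⟩
    have h2 : thetaNorm halfLine (q / 2) u (omegaFn (z j)) / wnorm (p / 2) v (omegaFn (z j)) ≤ C :=
      le_iSup₂_of_le (f := fun z (_ : 1 < z) =>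
        thetaNorm halfLine (q / 2) u (omegaFn z) / wnorm (p / 2) v (omegaFn z)) (z j) (hz j) le_rfl
    rw [ENNReal.div_le_iff_le_mul (Or.inr hC) (Or.inl hfin)] at h2
    calc c j * wnorm (q / 2) u (A (omegaFn (z j)))
        ≤ c j * (C * wnorm (p / 2) v (omegaFn (z j))) := mul_le_mul_right (h1.trans h2) _
      _ = C * (c j * wnorm (p / 2) v (omegaFn (z j))) := by ring
  have hnorm : wnorm (q / 2) u (fun t => ENNReal.ofReal ϑ *
      ∑ j ∈ Finset.range N, c j * A (omegaFn (z j)) t) ≤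
      ENNReal.ofReal ϑ * (2 * C * wnorm (p / 2) v (toENN h)) := by
    rw [wnorm_const_mul hq0 hu (Finset.aemeasurable_fun_sum _ fun j _ => (hAωm j).const_mul (c j))]
    refine mul_le_mul_right ?_ _
    calc wnorm (q / 2) u (fun t => ∑ j ∈ Finset.range N, c j * A (omegaFn (z j)) t)
        ≤ ∑ j ∈ Finset.range N, wnorm (q / 2) u (fun t => c j * A (omegaFn (z j)) t) :=
          wnorm_sum_le hq' hu _ fun j => (hAωm j).const_mul (c j)
      _ = ∑ j ∈ Finset.range N, c j * wnorm (q / 2) u (A (omegaFn (z j))) :=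
          Finset.sum_congr rfl fun j _ => wnorm_const_mul hq0 hu (hAωm j) (c j)
      _ ≤ ∑ j ∈ Finset.range N, C * (c j * wnorm (p / 2) v (omegaFn (z j))) :=
          Finset.sum_le_sum hterm
      _ = C * ∑ j ∈ Finset.range N, c j * wnorm (p / 2) v (omegaFn (z j)) :=
          (Finset.mul_sum _ _ _).symm
      _ ≤ C * (2 * wnorm (p / 2) v (toENN h)) := mul_le_mul_right hsum _
      _ = 2 * C * wnorm (p / 2) v (toENN h) := by ring
  refine le_trans ?_ (ENNReal.rpow_le_rpow hnorm hq0.le)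
  rw [wnorm_rpow_self hq0]
  refine le_trans (setLIntegral_mono' measurableSet_Ioo fun t ht => ?_)
    (lintegral_mono_set Ioo_subset_Ioi_self)
  have h1 := hT (toENN h)
    (fun t => ∑ j ∈ Finset.range N, (ENNReal.ofReal ϑ * c j) * omegaFn (z j) t)
    (fun t ht htT => (hlow t ht htT).trans
      (le_of_eq (by simp only [Finset.mul_sum, mul_assoc]))) t ht
  rw [hA.apply_sum _ _ hωm] at h1
  refine mul_le_mul_left (ENNReal.rpow_le_rpow (h1.trans (le_of_eq ?_)) hq0.le) _
  simp only [Finset.mul_sum, mul_assoc]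

/-! ### Reduction to the functions `ω_z` by the level function -/

theorem antitoneOn_levelFunction (u : ℝ → ℝ≥0∞) : AntitoneOn (levelFunction u) (Ioi 0) := by
  by_cases hline : UnderLine u
  · have : levelFunction u = levelFunction₀ u := by ext x; simp only [levelFunction, if_pos hline]
    exact this ▸ hline.antitoneOn_levelFunction₀
  · intro x hx y hy hxy
    simp only [levelFunction, if_neg hline]
    exact iSup_mono fun n => (underLine_truncation n).antitoneOn_levelFunction₀ hx hy hxy

theorem omegaFn_of_le {z t : ℝ} (ht : 0 < t) (htz : t ≤ z) :
    omegaFn z t = ENNReal.ofReal (z ^ 2)⁻¹ := by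
  rw [omegaFn, min_eq_right]
  gcongr

theorem lintegral_omegaFn_rpow_le {z q : ℝ} (hz : 0 < z) (hq : 1 < q) :
    ∫⁻ t in Ioi (0 : ℝ), omegaFn z t ^ (q / 2) ≤ ENNReal.ofReal (q / (q - 1) * z ^ (1 - q)) := by
  have hq2 : 0 < q / 2 := by linarith
  have hpow : ∀ t, 0 < t → omegaFn z t ^ (q / 2) =
      ENNReal.ofReal (min (t ^ q)⁻¹ (z ^ q)⁻¹) := by
    intro t ht
    rw [omegaFn_rpow hz ht hq2, mul_div_cancel₀ _ two_ne_zero]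
  rw [← Ioc_union_Ioi_eq_Ioi hz.le, lintegral_union measurableSet_Ioi
    (Set.disjoint_left.2 fun t (h1 : t ∈ Ioc 0 z) (h2 : t ∈ Ioi z) => h1.2.not_gt h2)]
  have h1 : ∫⁻ t in Ioc 0 z, omegaFn z t ^ (q / 2) ≤ ENNReal.ofReal (z ^ (1 - q)) := by
    refine (setLIntegral_mono' (g := fun _ => ENNReal.ofReal (z ^ q)⁻¹) measurableSet_Ioc
      fun t ht => ?_).trans ?_
    · rw [hpow t ht.1]
      exact ENNReal.ofReal_le_ofReal (min_le_right _ _)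
    · rw [setLIntegral_const, Real.volume_Ioc, ← ENNReal.ofReal_mul (by positivity), sub_zero,
        Real.rpow_sub hz, Real.rpow_one, div_eq_inv_mul]
  have h2 : ∫⁻ t in Ioi z, omegaFn z t ^ (q / 2) ≤ ENNReal.ofReal (z ^ (1 - q) / (q - 1)) := by
    have hi := integral_Ioi_rpow_of_lt (a := -q) (by linarith) hz
    have hint := integrableOn_Ioi_rpow_of_lt (a := -q) (by linarith) hz
    rw [show z ^ (1 - q) / (q - 1) = ∫ t in Ioi z, t ^ (-q) by
      rw [hi, ← neg_div_neg_eq]; congr 1 <;> ring_nf,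
      ofReal_integral_eq_lintegral_ofReal hint ((ae_restrict_iff' measurableSet_Ioi).2
        (Filter.Eventually.of_forall fun t ht => Real.rpow_nonneg (hz.le.trans (le_of_lt ht)) _))]
    refine setLIntegral_mono' measurableSet_Ioi fun t ht => ?_
    have ht0 : 0 < t := hz.trans ht
    rw [hpow t ht0, Real.rpow_neg ht0.le]
    exact ENNReal.ofReal_le_ofReal (min_le_left _ _)
  refine (add_le_add h1 h2).trans (le_of_eq ?_)
  have hzq : 0 < z ^ (1 - q) := Real.rpow_pos_of_pos hz _
  have hq1 : 0 < q - 1 := by linarith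
  rw [← ENNReal.ofReal_add hzq.le (by positivity)]
  congr 1
  field_simp
  ring

/-- A bound `∫₀ʸ u ≤ K y` for `y > z` passes to the level function with a factor of two, because the
line `K y + K x` majorizes `∫₀ˣ u`; `ω_z` is constant on `(0, z)`, where no bound is available. -/
theorem lintegral_omegaFn_levelFunction_le {u : ℝ → ℝ≥0∞} {z q K : ℝ} (hz : 1 < z) (hq : 1 < q)
    (hK : 0 ≤ K) (h : ∀ y, z < y → primitive u y ≤ ENNReal.ofReal (K * y)) :
    ∫⁻ t in Ioi (0 : ℝ), omegaFn z t ^ (q / 2) * levelFunction u t ≤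
      ENNReal.ofReal (2 * (q / (q - 1)) * (K * z ^ (1 - q))) := by
  have hz0 : 0 < z := by linarith
  have hbd : ∀ x y, 0 < x → z ≤ y → primitive u x ≤ ENNReal.ofReal (K * y + K * x) := by
    intro x y hx hy
    rcases lt_or_ge z x with h1 | h1
    · refine (h x h1).trans (ENNReal.ofReal_le_ofReal ?_)
      nlinarith [mul_nonneg hK (hz0.le.trans hy)]
    · refine (lintegral_mono_set (Ioo_subset_Ioo le_rfl (by linarith : x ≤ z + x))).trans
        ((h (z + x) (by linarith)).trans (ENNReal.ofReal_le_ofReal ?_))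
      nlinarith [mul_le_mul_of_nonneg_left hy hK]
  have hfin : ∀ x, 0 < x → primitive u x ≠ ∞ := fun x hx =>
    ne_top_of_le_ne_top ENNReal.ofReal_ne_top (hbd x z hx le_rfl)
  have hreal : ∀ x y, 0 < x → z ≤ y → (primitive u x).toReal ≤ K * y + K * x := fun x y hx hy => by
    have := ENNReal.toReal_mono ENNReal.ofReal_ne_top (hbd x y hx hy)
    rwa [ENNReal.toReal_ofReal
      (by nlinarith [mul_nonneg hK hx.le, mul_nonneg hK (hz0.le.trans hy)])] at this
  have hline : UnderLine u := ⟨K * z, K, fun x hx => ⟨hfin x hx, hreal x z hx le_rfl⟩⟩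
  simp only [levelFunction, if_pos hline]
  have hanti := antitoneOn_omegaFn hz.le
  have hq2 : 0 < q / 2 := by linarith
  have hωfin : ∀ t, omegaFn z t ^ (q / 2) ≠ ∞ := fun t =>
    ENNReal.rpow_ne_top_of_nonneg hq2.le ENNReal.ofReal_ne_top
  have hle := hardy_lemma (z := z) (f := fun t => omegaFn z t ^ (q / 2)) (a := levelFunction₀ u)
    (b := fun _ => ENNReal.ofReal (2 * K))
    (fun x hx y hy hxy => ENNReal.rpow_le_rpow (hanti hx hy hxy) hq2.le) (fun t _ => hωfin t)
    (fun s hs t ht => by rw [omegaFn_of_le hs.1 hs.2.le, omegaFn_of_le ht.1 ht.2.le])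
    (measurable_of_antitoneOn hline.antitoneOn_levelFunction₀) aemeasurable_const
    (fun y hy hzy => by
      rw [hline.lintegral_levelFunction₀ hy, setLIntegral_const, Real.volume_Ioo, sub_zero,
        ← ENNReal.ofReal_mul (by positivity)]
      refine ENNReal.ofReal_le_ofReal ?_
      have := leastConcaveMajorant_le (U := fun x => (primitive u x).toReal)
        (concaveOn_line (K * y) K _ (convex_Ioi 0)) (fun x hx => hreal x y hx hzy) hy
      linarith)
  refine hle.trans ?_
  rw [lintegral_mul_const' _ _ ENNReal.ofReal_ne_top]
  refine (mul_le_mul_left (lintegral_omegaFn_rpow_le hz0 hq) _).trans (le_of_eq ?_)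
  rw [← ENNReal.ofReal_mul' (by positivity)]
  congr 1
  ring

/-- The substitution `t ↦ 1 / t`. -/
theorem lintegral_omegaFn_dualWeight {p z : ℝ} (hp : 0 < p) (hz : 0 < z) (v : ℝ → ℝ≥0∞) :
    ∫⁻ t in Ioi (0 : ℝ), omegaFn z⁻¹ t ^ (p / 2) * dualWeight p v t =
      ENNReal.ofReal (z ^ p) * ∫⁻ t in Ioi (0 : ℝ), omegaFn z t ^ (p / 2) * v t := by
  have himg : (fun t : ℝ => t⁻¹) '' Ioi 0 = Ioi 0 := by
    ext t
    simp only [mem_image, mem_Ioi]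
    exact ⟨fun ⟨s, hs, e⟩ => e ▸ inv_pos.2 hs, fun ht => ⟨t⁻¹, inv_pos.2 ht, inv_inv t⟩⟩
  have hcv := lintegral_image_eq_lintegral_abs_deriv_mul (s := Ioi 0) (f := fun t : ℝ => t⁻¹)
    (f' := fun t => -(t ^ 2)⁻¹) measurableSet_Ioi
    (fun t ht => (hasDerivAt_inv (ne_of_gt ht)).hasDerivWithinAt) inv_injective.injOn
    (fun t => omegaFn z t ^ (p / 2) * v t)
  rw [himg] at hcv
  rw [hcv, ← lintegral_const_mul' _ _ ENNReal.ofReal_ne_top]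
  refine setLIntegral_congr_fun measurableSet_Ioi fun t ht => ?_
  have ht0 : 0 < t := ht
  have hp2 : 0 < p / 2 := by positivity
  simp only [dualWeight, one_div]
  rw [omegaFn_rpow (inv_pos.2 hz) ht0 hp2, omegaFn_rpow hz (inv_pos.2 ht0) hp2,
    mul_div_cancel₀ _ two_ne_zero, abs_neg, abs_of_pos (by positivity), ← mul_assoc, ← mul_assoc,
    ← mul_assoc, ← ENNReal.ofReal_mul (by positivity), ← ENNReal.ofReal_mul (by positivity),
    ← ENNReal.ofReal_mul (by positivity)]
  congr 2
  have htp : 0 < t ^ p := Real.rpow_pos_of_pos ht0 _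
  have hzp : 0 < z ^ p := Real.rpow_pos_of_pos hz _
  rw [Real.inv_rpow hz.le, Real.inv_rpow ht0.le, inv_inv, inv_inv, Real.rpow_sub ht0,
    Real.rpow_two, min_mul_of_nonneg _ _ (by positivity), mul_min_of_nonneg _ _ (by positivity),
    min_comm]
  congr 1 <;> field_simp

/-- A common bound for the norms of the `ω_z` passes to the cone: decompose `h ^ (q/2)`, integrate
term by term against the level function, and use the reverse Minkowski inequality with exponent
`p/q` for the weight `v`. -/
theorem thetaNorm_le_of_forall_omega {p q : ℝ} (hp : 0 < p) (hpq : p ≤ q) (hq2 : 2 ≤ q)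
    {u v : ℝ → ℝ≥0∞} (hu : AEMeasurable u (volume.restrict (Ioi 0)))
    (hv : AEMeasurable v (volume.restrict (Ioi 0))) {D : ℝ≥0∞}
    (hD : ∀ z, 1 < z → wnorm (p / 2) v (omegaFn z) ≠ ∞ →
      ∫⁻ t in Ioi (0 : ℝ), omegaFn z t ^ (q / 2) * levelFunction u t ≤
        D * wnorm (p / 2) v (omegaFn z) ^ (q / 2)) {h : ℝ → ℝ≥0} (hh : h ∈ coneP)
    (hV : wnorm (p / 2) v (toENN h) ≠ ∞) :
    thetaNorm halfLine (q / 2) u (toENN h) ≤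
      (2 * D) ^ (2 / q) * wnorm (p / 2) v (toENN h) := by
  have hq0 : 0 < q := by linarith
  have hq' : 0 < q / 2 := by linarith
  have hp' : 0 < p / 2 := by linarith
  have hρ : 0 < p / q := by positivity
  have hρ1 : p / q ≤ 1 := (div_le_one hq0).2 hpq
  have hψm := measurable_of_antitoneOn (antitoneOn_levelFunction u)
  have hhm := measurable_of_antitoneOn (antitoneOn_toENN hh)
  have hwr : ∀ f : ℝ → ℝ≥0∞, wnorm (p / q) v (fun t => f t ^ (q / 2)) =
      wnorm (p / 2) v f ^ (q / 2) := by
    intro f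
    simp only [wnorm, ← ENNReal.rpow_mul]
    rw [show q / 2 * (p / q) = p / 2 by field_simp, show 1 / (p / 2) * (q / 2) = 1 / (p / q) by
      field_simp]
  refine (thetaNorm_le_levelFunction hh (by linarith) hu).trans ?_
  rw [wnorm, one_div, ENNReal.rpow_inv_le_iff hq', ENNReal.mul_rpow_of_nonneg _ _ hq'.le,
    ← ENNReal.rpow_mul, show 2 / q * (q / 2) = 1 by field_simp, ENNReal.rpow_one]
  refine le_of_forall_one_lt_mul fun ϑ hϑ => ?_
  rw [lintegral_Ioi_eq_iSup]
  refine iSup_le fun n => ?_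
  obtain ⟨N, c, z, hz, hlow, hup⟩ := exists_omega_sum hh hq' hϑ n
  have hωm : ∀ j, AEMeasurable (fun t => omegaFn (z j) t ^ (q / 2)) (volume.restrict (Ioi 0)) :=
    fun j => (measurable_of_antitoneOn (antitoneOn_omegaFn (hz j).le)).pow_const _
  have hsum : ∑ j ∈ Finset.range N, c j * wnorm (p / 2) v (omegaFn (z j)) ^ (q / 2) ≤
      2 * wnorm (p / 2) v (toENN h) ^ (q / 2) := by
    calc ∑ j ∈ Finset.range N, c j * wnorm (p / 2) v (omegaFn (z j)) ^ (q / 2)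
        = ∑ j ∈ Finset.range N, wnorm (p / q) v (fun t => c j * omegaFn (z j) t ^ (q / 2)) :=
          Finset.sum_congr rfl fun j _ => by rw [wnorm_const_mul hρ hv (hωm j), hwr]
      _ ≤ wnorm (p / q) v (fun t => ∑ j ∈ Finset.range N, c j * omegaFn (z j) t ^ (q / 2)) :=
          sum_wnorm_le hρ hρ1 hv _ fun j => (hωm j).const_mul (c j)
      _ ≤ wnorm (p / q) v (fun t => 2 * toENN h t ^ (q / 2)) := wnorm_mono hρ hup
      _ = 2 * wnorm (p / 2) v (toENN h) ^ (q / 2) := by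
          rw [wnorm_const_mul hρ hv (hhm.pow_const _), hwr]
  have hterm : ∀ j ∈ Finset.range N,
      c j * ∫⁻ t in Ioi (0 : ℝ), omegaFn (z j) t ^ (q / 2) * levelFunction u t ≤
        D * (c j * wnorm (p / 2) v (omegaFn (z j)) ^ (q / 2)) := by
    intro j hj
    by_cases hc : c j = 0
    · simp [hc]
    have hfin : wnorm (p / 2) v (omegaFn (z j)) ≠ ∞ := by
      intro htop
      have h1 := (Finset.single_le_sum
        (f := fun j => c j * wnorm (p / 2) v (omegaFn (z j)) ^ (q / 2))
        (fun _ _ => zero_le) hj).trans hsum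
      simp only [htop, ENNReal.top_rpow_of_pos hq', ENNReal.mul_top hc, top_le_iff] at h1
      exact ENNReal.mul_ne_top (by simp) (ENNReal.rpow_ne_top_of_nonneg hq'.le hV) h1
    exact (mul_le_mul_right (hD _ (hz j) hfin) _).trans (le_of_eq (by ring))
  calc ∫⁻ t in Ioo (0 : ℝ) n, toENN h t ^ (q / 2) * levelFunction u t
      ≤ ∫⁻ t in Ioi (0 : ℝ), ENNReal.ofReal ϑ * ∑ j ∈ Finset.range N,
          c j * (omegaFn (z j) t ^ (q / 2) * levelFunction u t) := by
        refine le_trans (setLIntegral_mono' measurableSet_Ioo fun t ht => ?_)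
          (lintegral_mono_set Ioo_subset_Ioi_self)
        refine (mul_le_mul_left (hlow t ht.1 ht.2.le) _).trans (le_of_eq ?_)
        rw [mul_assoc, Finset.sum_mul]
        simp only [mul_assoc]
    _ = ENNReal.ofReal ϑ * ∑ j ∈ Finset.range N,
          c j * ∫⁻ t in Ioi (0 : ℝ), omegaFn (z j) t ^ (q / 2) * levelFunction u t := by
        rw [lintegral_const_mul' _ _ ENNReal.ofReal_ne_top,
          lintegral_finsetSum'
            (f := fun j t => c j * (omegaFn (z j) t ^ (q / 2) * levelFunction u t)) _
            fun j _ => ((hωm j).mul hψm).const_mul (c j)]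
        congr 1
        exact Finset.sum_congr rfl fun j _ => lintegral_const_mul''
          (f := fun t => omegaFn (z j) t ^ (q / 2) * levelFunction u t) _ ((hωm j).mul hψm)
    _ ≤ ENNReal.ofReal ϑ * ∑ j ∈ Finset.range N,
          D * (c j * wnorm (p / 2) v (omegaFn (z j)) ^ (q / 2)) :=
        mul_le_mul_right (Finset.sum_le_sum hterm) _
    _ ≤ ENNReal.ofReal ϑ * (D * (2 * wnorm (p / 2) v (toENN h) ^ (q / 2))) := by
        rw [← Finset.mul_sum]
        exact mul_le_mul_right (mul_le_mul_right hsum _) _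
    _ = ENNReal.ofReal ϑ * (2 * D * wnorm (p / 2) v (toENN h) ^ (q / 2)) := by ring

theorem CTheta_le_of_le {p q : ℝ} (hp : 0 < p) (hpq : p ≤ q) (hq2 : 2 ≤ q)
    {u v : ℝ → ℝ≥0∞} (hu : AEMeasurable u (volume.restrict (Ioi 0)))
    (hv : AEMeasurable v (volume.restrict (Ioi 0))) :
    CTheta p q u v ≤ ENNReal.ofReal ((4 * (q / (q - 1))) ^ (2 / q)) *
      ⨆ (x : ℝ) (y : ℝ) (_ : 1 < 1 / x) (_ : 1 / x < y),
        (ENNReal.ofReal (1 / (x * y)) * ∫⁻ t in Ioo 0 y, u t) ^ (2 / q) *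
          (∫⁻ t in Ioi (0 : ℝ), omegaFn x t ^ (p / 2) * dualWeight p v t) ^ (-(2 / p)) := by
  have hq0 : 0 < q := by linarith
  have hq' : 0 < q / 2 := by linarith
  have hq1 : 0 < q - 1 := by linarith
  have hconst : 0 < (4 * (q / (q - 1))) ^ (2 / q) := by positivity
  set B := ⨆ (x : ℝ) (y : ℝ) (_ : 1 < 1 / x) (_ : 1 / x < y),
        (ENNReal.ofReal (1 / (x * y)) * ∫⁻ t in Ioo 0 y, u t) ^ (2 / q) *
          (∫⁻ t in Ioi (0 : ℝ), omegaFn x t ^ (p / 2) * dualWeight p v t) ^ (-(2 / p)) with hB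
  by_cases hBtop : B = ∞
  · rw [hBtop, ENNReal.mul_top (by simpa using hconst)]
    exact le_top
  refine iSup₂_le fun h hh => ?_
  by_cases hV : wnorm (p / 2) v (toENN h) = ∞
  · simp [hV]
  refine ENNReal.div_le_of_le_mul ((thetaNorm_le_of_forall_omega hp hpq hq2 hu hv
    (D := ENNReal.ofReal (2 * (q / (q - 1))) * B ^ (q / 2)) (fun z hz hVz => ?_) hh hV).trans
      (le_of_eq ?_))
  · have hz0 : 0 < z := by linarith
    set V := wnorm (p / 2) v (omegaFn z) with hVdef
    have hX : (∫⁻ t in Ioi (0 : ℝ), omegaFn z⁻¹ t ^ (p / 2) * dualWeight p v t) ^ (2 / p) =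
        ENNReal.ofReal (z ^ (2 : ℝ)) * V := by
      rw [lintegral_omegaFn_dualWeight hp hz0, ENNReal.mul_rpow_of_nonneg _ _ (by positivity),
        ENNReal.ofReal_rpow_of_nonneg (by positivity) (by positivity), ← Real.rpow_mul hz0.le,
        mul_div_cancel₀ _ hp.ne', hVdef, wnorm, one_div_div]
    have hXtop : ENNReal.ofReal (z ^ (2 : ℝ)) * V ≠ ∞ := by finiteness
    -- the bound for the means of `u` beyond `z` that the supremum provides
    have hmean : ∀ y, z < y → ENNReal.ofReal (z / y) * primitive u y ≤
        B ^ (q / 2) * (ENNReal.ofReal (z ^ q) * V ^ (q / 2)) := by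
      intro y hy
      have h1 : (ENNReal.ofReal (1 / (z⁻¹ * y)) * ∫⁻ t in Ioo 0 y, u t) ^ (2 / q) *
          (∫⁻ t in Ioi (0 : ℝ), omegaFn z⁻¹ t ^ (p / 2) * dualWeight p v t) ^ (-(2 / p)) ≤ B :=
        le_iSup_of_le z⁻¹ (le_iSup_of_le y (le_iSup_of_le (by simpa using hz)
          (le_iSup_of_le (by simpa using hy) le_rfl)))
      rw [ENNReal.rpow_neg, hX, ← div_eq_mul_inv,
        ENNReal.div_le_iff_le_mul (Or.inr hBtop) (Or.inl hXtop),
        show 1 / (z⁻¹ * y) = z / y by field_simp] at h1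
      have h2 := ENNReal.rpow_le_rpow h1 hq'.le
      rw [← ENNReal.rpow_mul, show 2 / q * (q / 2) = 1 by field_simp, ENNReal.rpow_one,
        ENNReal.mul_rpow_of_nonneg _ _ hq'.le, ENNReal.mul_rpow_of_nonneg _ _ hq'.le,
        ENNReal.ofReal_rpow_of_nonneg (by positivity) hq'.le, ← Real.rpow_mul hz0.le,
        mul_div_cancel₀ _ two_ne_zero] at h2
      exact h2
    set W := B ^ (q / 2) * V ^ (q / 2) with hW
    have hWtop : W ≠ ∞ := ENNReal.mul_ne_top (ENNReal.rpow_ne_top_of_nonneg hq'.le hBtop)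
      (ENNReal.rpow_ne_top_of_nonneg hq'.le hVz)
    have hzq : 0 < z ^ (q - 1) := Real.rpow_pos_of_pos hz0 _
    refine (lintegral_omegaFn_levelFunction_le (K := W.toReal * z ^ (q - 1)) hz (by linarith)
      (by positivity) fun y hy => ?_).trans (le_of_eq ?_)
    · have hy0 : 0 < y := hz0.trans hy
      have h3 := mul_le_mul_right (hmean y hy) (ENNReal.ofReal (y / z))
      rw [← mul_assoc, ← ENNReal.ofReal_mul (by positivity), show y / z * (z / y) = 1 by field_simp,
        ENNReal.ofReal_one, one_mul] at h3
      refine h3.trans (le_of_eq ?_)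
      rw [show B ^ (q / 2) * (ENNReal.ofReal (z ^ q) * V ^ (q / 2)) =
        ENNReal.ofReal (z ^ q) * W by rw [hW]; ring, ← mul_assoc,
        ← ENNReal.ofReal_mul (by positivity), ← ENNReal.ofReal_toReal hWtop,
        ← ENNReal.ofReal_mul (by positivity), ENNReal.toReal_ofReal ENNReal.toReal_nonneg,
        Real.rpow_sub_one hz0.ne']
      congr 1
      ring
    · have h4 : z ^ (q - 1) * z ^ (1 - q) = 1 := by
        rw [← Real.rpow_add hz0]; simp
      rw [show W.toReal * z ^ (q - 1) * z ^ (1 - q) = W.toReal by rw [mul_assoc, h4, mul_one],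
        ENNReal.ofReal_mul (by positivity), ENNReal.ofReal_toReal hWtop, hW, mul_assoc]
  · rw [← mul_assoc, show (2 : ℝ≥0∞) = ENNReal.ofReal 2 by simp, ← ENNReal.ofReal_mul (by norm_num),
      ENNReal.mul_rpow_of_nonneg _ _ (by positivity), ← ENNReal.rpow_mul,
      show q / 2 * (2 / q) = 1 by field_simp, ENNReal.rpow_one,
      ENNReal.ofReal_rpow_of_nonneg (by positivity) (by positivity)]
    ring_nf

/-! ### The four estimates -/

theorem proposition4p4 (p q : ℝ) (hp : 0 < p) (hq : 0 < q) (u v : ℝ → ℝ≥0∞)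
    (hu : u ∈ LPlus) (hv : v ∈ LPlus) :
    (CTheta p q u v ≤ ⨆ h ∈ coneP,
        (∫⁻ t in Ioi (0 : ℝ), hardyMean (toENN h) t ^ (q / 2) * u t) ^ (2 / q) *
          (∫⁻ t in Ioi (0 : ℝ), toENN h t ^ (p / 2) * v t) ^ (-(2 / p))) ∧
    (2 ≤ q →
      CTheta p q u v = (⨆ h ∈ coneP, ⨆ A ∈ averagingOperators,
        wnorm (q / 2) u (A (toENN h)) / wnorm (p / 2) v (toENN h)) ∧
      CTheta p q u v ≤ ⨆ h ∈ coneP,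
        (∫⁻ t in Ioi (0 : ℝ), toENN h t ^ (q / 2) * levelFunction u t) ^ (2 / q) *
          (∫⁻ t in Ioi (0 : ℝ), toENN h t ^ (p / 2) * v t) ^ (-(2 / p))) ∧
    (p ≤ q → 2 ≤ q →
      CTheta p q u v ≤ ENNReal.ofReal ((4 * (q / (q - 1))) ^ (2 / q)) *
        ⨆ (x : ℝ) (y : ℝ) (_ : 1 < 1 / x) (_ : 1 / x < y),
          (ENNReal.ofReal (1 / (x * y)) * ∫⁻ t in Ioo 0 y, u t) ^ (2 / q) *
            (∫⁻ t in Ioi (0 : ℝ), omegaFn x t ^ (p / 2) * dualWeight p v t) ^ (-(2 / p))) ∧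
    (p ≤ 2 → 2 ≤ q → CTheta p q u v ≤ 2 * COmega p q u v) := by
  have hu' : AEMeasurable u (volume.restrict (Ioi 0)) := hu
  have hv' : AEMeasurable v (volume.restrict (Ioi 0)) := hv
  have hdiv : ∀ (w f g : ℝ → ℝ≥0∞), wnorm (q / 2) w f / wnorm (p / 2) v g =
      (∫⁻ t in Ioi (0 : ℝ), f t ^ (q / 2) * w t) ^ (2 / q) *
        (∫⁻ t in Ioi (0 : ℝ), g t ^ (p / 2) * v t) ^ (-(2 / p)) := fun w f g => by
    rw [wnorm, wnorm, one_div_div, one_div_div, ENNReal.rpow_neg, div_eq_mul_inv]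
  refine ⟨?_, fun hq2 => ⟨?_, ?_⟩, fun hpq hq2 => CTheta_le_of_le hp hpq hq2 hu' hv',
    fun hp2 hq2 => CTheta_le_two_mul_COmega hp hp2 hq2 hu' hv'⟩
  · refine iSup₂_mono fun h hh => ?_
    rw [← hdiv]
    exact ENNReal.div_le_div_right (thetaNorm_le_hardyMean hh (by positivity)) _
  · refine iSup_congr fun h => iSup_congr fun hh => ?_
    rw [thetaNorm_eq_iSup_average hh (by linarith) hu']
    simp only [div_eq_mul_inv, ENNReal.iSup_mul]
  · refine iSup₂_mono fun h hh => ?_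
    rw [← hdiv]
    exact ENNReal.div_le_div_right (thetaNorm_le_levelFunction hh (by linarith) hu') _
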